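/- Let $M$ be a complex surface (complex manifold of complex dimension 2). For holomorphic functions $u,v,f$ on an open subset $U\subseteq M$ put $\lambda=1+|f|^2$ and $$\varphi_1=\frac{1}{\sqrt2\,\sqrt\lambda}\,du+\frac{1}{\sqrt2\,\lambda\sqrt\lambda}\,(i\overline v-u\overline f)\,df,\qquad \varphi_2=\frac{1}{\sqrt2\,\sqrt\lambda}\,dv-\frac{1}{\sqrt2\,\lambda\sqrt\lambda}\,(i\overline u+v\overline f)\,df .$$ A pair of $(1,0)$-forms $\varphi_1,\varphi_2$ on $U$ is called a unitary coframe of a Hermitian metric $g$ on $U$ if it is a basis of the $(1,0)$-covectors at every point of $U$ and $g=\sum_i(\varphi_i\otimes\overline{\varphi_i}+\overline{\varphi_i}\otimes\varphi_i)$ on $U$, i.e. the metric form of $g$ is $i\sum_i\varphi_i\wedge\overline{\varphi_i}$. (a) Let $g$ be a smooth Hermitian metric on $M$ whose Riemannian (Levi-Civita) connection is flat. Then every $p\in M$ has an open neighborhood $U\subseteq M$ with holomorphic functions $u,v,f$ on $U$ such that $\{\varphi_1,\varphi_2\}$ is a unitary coframe of $g$ on $U$. (b) Conversely, if $u,v,f$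 are holomorphic functions on $M$ such that $\varphi_1\wedge\varphi_2$ is nowhere zero, then there is exactly one smooth Hermitian metric $g$ on $M$ with $\{\varphi_1,\varphi_2\}$ as a unitary coframe, and the Riemannian connection of $g$ is flat. -/

import Mathlib

open scoped Manifold ContDiff

/-- The real manifold underlying a complex manifold. -/
instance complexManifold_isManifold_real {E : Type*} [NormedAddCommGroup E] [NormedSpace ℂ E]
    {M : Type*} [TopologicalSpace M] [ChartedSpace E M] {n : ℕ∞ω}
    [IsManifold 𝓘(ℂ, E) n M] : IsManifold 𝓘(ℝ, E) n M := by
  refine isManifold_of_contDiffOn 𝓘(ℝ, E) n M fun e e' he he' ↦ ?_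
  have h := (contDiffGroupoid n 𝓘(ℂ, E)).compatible he he'
  rw [contDiffGroupoid, mem_groupoid_of_pregroupoid] at h
  exact h.1.restrict_scalars ℝ

/-! ### The Levi-Civita connection and its curvature in coordinates -/

section Coordinates

variable {E : Type*} [NormedAddCommGroup E] [NormedSpace ℝ E]

/-- For a field `G` of nondegenerate symmetric bilinear forms on an open subset of `E`, the
Christoffel symbol `Γ_y(v, w)`: the value at `y` of the Levi-Civita derivative `∇_v w` of the
constant vector field `w`, given by Koszul's formula
`G(Γ(v, w), z) = (∂_v G(w, z) + ∂_w G(v, z) - ∂_z G(v, w)) / 2` for all `z`. -/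
noncomputable def christoffel (G : E → E →L[ℝ] E →L[ℝ] ℝ) (y v w : E) : E :=
  (G y).inverse ((1 / 2 : ℝ) •
    (fderiv ℝ G y v w + fderiv ℝ G y w v - ((fderiv ℝ G y).flip v).flip w))

/-- The curvature `R_y(v, w) z = ∇_v ∇_w z - ∇_w ∇_v z` of the Levi-Civita connection of `G`, for
constant (hence commuting) vector fields `v`, `w`, `z`. -/
noncomputable def leviCivitaCurvature (G : E → E →L[ℝ] E →L[ℝ] ℝ) (y v w z : E) : E :=
  fderiv ℝ (fun x ↦ christoffel G x w z) y v - fderiv ℝ (fun x ↦ christoffel G x v z) y w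
    + christoffel G y v (christoffel G y w z) - christoffel G y w (christoffel G y v z)

end Coordinates

section Manifold

variable {E : Type*} [NormedAddCommGroup E] [NormedSpace ℂ E]
  {M : Type*} [TopologicalSpace M] [ChartedSpace E M]

/-- A (smooth) Hermitian metric on a complex manifold: a smooth Riemannian metric for which the
complex structure, i.e. multiplication by `i` on the tangent spaces, is orthogonal. -/
structure HermitianMetric (E : Type*) [NormedAddCommGroup E] [NormedSpace ℂ E]
    (M : Type*) [TopologicalSpace M] [ChartedSpace E M] [IsManifold 𝓘(ℂ, E) ω M] extends
    Bundle.ContMDiffRiemannianMetric 𝓘(ℝ, E) ∞ E (fun x : M ↦ TangentSpace 𝓘(ℝ, E) x) where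
  inner_I_smul (x : M) (v w : TangentSpace 𝓘(ℂ, E) x) :
    inner x (Complex.I • v) (Complex.I • w) = inner x v w

/-- The expression of the metric in the coordinates given by a chart `e`: the pullback of the
metric by `e.symm`, which is meaningful on `e.target`. -/
noncomputable def HermitianMetric.inChart [IsManifold 𝓘(ℂ, E) ω M] (g : HermitianMetric E M)
    (e : OpenPartialHomeomorph M E) (y : E) : E →L[ℝ] E →L[ℝ] ℝ :=
  letI D : E →L[ℝ] E := mfderiv 𝓘(ℝ, E) 𝓘(ℝ, E) e.symm y
  letI B : E →L[ℝ] E →L[ℝ] ℝ := g.inner (e.symm y)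
  B.bilinearComp D D

/-- The Riemannian (Levi-Civita) connection of the metric is flat: its curvature tensor vanishes
identically, in every chart of the atlas. -/
def HermitianMetric.IsRiemannianFlat [IsManifold 𝓘(ℂ, E) ω M] (g : HermitianMetric E M) : Prop :=
  ∀ e ∈ atlas E M, ∀ y ∈ e.target, ∀ v w z : E, leviCivitaCurvature (g.inChart e) y v w z = 0

/-- The `(1,0)`-forms `φ₁, φ₂` form a unitary coframe of the Hermitian surface on `U`: they are
a basis of the `(1,0)`-covectors at each point of `U`, and
`g = ∑ᵢ (φᵢ ⊗ conj φᵢ + conj φᵢ ⊗ φᵢ)` there; equivalently, the metric form is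
`i ∑ᵢ φᵢ ∧ conj φᵢ`, or the dual frame `e` satisfies `⟨eᵢ, conj eⱼ⟩ = δᵢⱼ` for the complex
bilinear extension of `g`. -/
def HermitianMetric.IsUnitaryCoframeOn [IsManifold 𝓘(ℂ, E) ω M] (g : HermitianMetric E M)
    (φ₁ φ₂ : (x : M) → TangentSpace 𝓘(ℂ, E) x →L[ℂ] ℂ) (U : Set M) : Prop :=
  ∀ x ∈ U,
    (LinearIndependent ℂ ![φ₁ x, φ₂ x] ∧ ⊤ ≤ Submodule.span ℂ {φ₁ x, φ₂ x}) ∧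
    ∀ v w : TangentSpace 𝓘(ℂ, E) x, ((g.inner x v w : ℝ) : ℂ) =
      φ₁ x v * (starRingEnd ℂ) (φ₁ x w) + (starRingEnd ℂ) (φ₁ x v) * φ₁ x w +
      (φ₂ x v * (starRingEnd ℂ) (φ₂ x w) + (starRingEnd ℂ) (φ₂ x v) * φ₂ x w)

/-- The wedge product `φ₁ ∧ φ₂` of two `(1,0)`-forms, evaluated on tangent vectors at `x`. -/
noncomputable def wedgeAt (φ₁ φ₂ : (x : M) → TangentSpace 𝓘(ℂ, E) x →L[ℂ] ℂ) (x : M)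
    (v w : TangentSpace 𝓘(ℂ, E) x) : ℂ :=
  φ₁ x v * φ₂ x w - φ₁ x w * φ₂ x v

/-- `λ = 1 + |f|²`. -/
noncomputable def lam (f : M → ℂ) (x : M) : ℝ := 1 + ‖f x‖ ^ 2

variable (E) in
/-- `φ₁ = (1 / (√2 √λ)) du + (1 / (√2 λ √λ)) (i conj v - u conj f) df`. -/
noncomputable def phiOne (u v f : M → ℂ) (x : M) : TangentSpace 𝓘(ℂ, E) x →L[ℂ] ℂ :=
  ((1 / (√2 * √(lam f x)) : ℝ) : ℂ) • mvfderiv 𝓘(ℂ, E) u x +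
    (((1 / (√2 * lam f x * √(lam f x)) : ℝ) : ℂ) *
      (Complex.I * (starRingEnd ℂ) (v x) - u x * (starRingEnd ℂ) (f x))) •
        mvfderiv 𝓘(ℂ, E) f x

variable (E) in
/-- `φ₂ = (1 / (√2 √λ)) dv - (1 / (√2 λ √λ)) (i conj u + v conj f) df`. -/
noncomputable def phiTwo (u v f : M → ℂ) (x : M) : TangentSpace 𝓘(ℂ, E) x →L[ℂ] ℂ :=
  ((1 / (√2 * √(lam f x)) : ℝ) : ℂ) • mvfderiv 𝓘(ℂ, E) v x -
    (((1 / (√2 * lam f x * √(lam f x)) : ℝ) : ℂ) *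
      (Complex.I * (starRingEnd ℂ) (u x) + v x * (starRingEnd ℂ) (f x))) •
        mvfderiv 𝓘(ℂ, E) f x

end Manifold

/-! Everything rests on the change of variables u = A - i f conj B, v = B + i f conj A, with (A, B)
real Euclidean coordinates on ℂ² = ℝ⁴. It gives i conj v - u conj f = iλ conj B and i conj u + v
conj f = iλ conj A. The df terms of φ₁, φ₂ therefore cancel those in du, dv, leaving φ₁ = s (dA - i
f conj dB) and φ₂ = s (dB + i f conj dA) with 2λs² = 1. The cross terms drop out of ∑ (φᵢ ⊗ conj φᵢ
+ conj φᵢ ⊗ φᵢ), which is then the Euclidean metric in A and B (`coframeSum_fderiv_eq`).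

For (a), a flat metric is locally Euclidean (`exists_isometry_of_flat`). A parallel coframe exists
by Frobenius, is closed because the connection has no torsion, and integrates to an isometry (A, B).
The complex structure of M becomes an orthogonal complex structure on a domain of ℝ⁴. If the
differential of (A, B) is complex linear at the base point, this structure is described nearby by
one function k, through ∂̄A = k conj(∂B) and ∂̄B = -k conj(∂A) (`exists_antiPart_eq`). This is the
twistor coordinate on the sphere of orthogonal complex structures. Symmetry of second derivatives
forces ∂̄k = 0 (`antiPart_fderiv_eq_zero`), so A - k conj B and B + k conj A are holomorphic as
well. They serve as u and v, with f = -ik.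

For (b), the linear relations can be solved for A and B because λ > 0. The Euclidean metric pulled
back by (A, B) has φ₁, φ₂ as unitary coframe. Nonvanishing of φ₁ ∧ φ₂ makes (A, B) a local
diffeomorphism, so the pullback is a flat metric (`leviCivitaCurvature_pullback_eq_zero`).
Uniqueness holds because the coframe determines the metric pointwise. -/

set_option maxSynthPendingDepth 3

/-! ### Linear total differential equations: Frobenius' theorem by Picard iteration -/

section Frobenius

set_option linter.unusedSectionVars false

open Metric Filter Topology intervalIntegral

variable {E F X : Type*} [NormedAddCommGroup E] [NormedSpace ℝ E] [FiniteDimensional ℝ E]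
  [NormedAddCommGroup F] [NormedSpace ℝ F] [CompleteSpace F]
  [NormedAddCommGroup X] [NormedSpace ℝ X] [CompleteSpace X]

theorem hasFDerivAt_intervalIntegral_of_contDiff {K : E × ℝ → F} (hK : ContDiff ℝ 1 K) (y : E) :
    HasFDerivAt (fun x ↦ ∫ t in (0 : ℝ)..1, K (x, t))
      (∫ t in (0 : ℝ)..1, (fderiv ℝ K (y, t)).comp (ContinuousLinearMap.inl ℝ E ℝ)) y := by
  have hc : Continuous fun p : E × ℝ ↦ (fderiv ℝ K p).comp (ContinuousLinearMap.inl ℝ E ℝ) :=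
    (hK.continuous_fderiv one_ne_zero).clm_comp continuous_const
  obtain ⟨C, hC⟩ := ((isCompact_closedBall y 1).prod
    (isCompact_Icc (a := (0 : ℝ)) (b := 1))).exists_bound_of_continuousOn hc.continuousOn
  have hs (x : E) : Continuous fun t : ℝ ↦ K (x, t) := hK.continuous.comp (by fun_prop)
  refine hasFDerivAt_integral_of_dominated_of_fderiv_le (bound := fun _ ↦ C)
    (F' := fun x t ↦ (fderiv ℝ K (x, t)).comp (ContinuousLinearMap.inl ℝ E ℝ))
    (closedBall_mem_nhds y one_pos)
    (Eventually.of_forall fun x ↦ (hs x).aestronglyMeasurable) ((hs y).intervalIntegrable _ _)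
    (hc.comp (by fun_prop : Continuous fun t : ℝ ↦ (y, t))).aestronglyMeasurable ?_
    intervalIntegrable_const ?_
  · refine Eventually.of_forall fun t ht x hx ↦ hC (x, t) ⟨hx, ?_⟩
    rw [Set.uIoc_of_le zero_le_one] at ht
    exact ⟨ht.1.le, ht.2⟩
  · refine Eventually.of_forall fun t _ x _ ↦ ?_
    exact ((hK.differentiable one_ne_zero (x, t)).hasFDerivAt).comp x
      (hasFDerivAt_prodMk_left x t)

theorem contDiff_one_intervalIntegral {K : E × ℝ → F} (hK : ContDiff ℝ 1 K) :
    ContDiff ℝ 1 fun x ↦ ∫ t in (0 : ℝ)..1, K (x, t) := by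
  rw [contDiff_one_iff_fderiv]
  refine ⟨fun y ↦ (hasFDerivAt_intervalIntegral_of_contDiff hK y).differentiableAt, ?_⟩
  rw [funext fun y ↦ (hasFDerivAt_intervalIntegral_of_contDiff hK y).fderiv]
  refine continuous_parametric_intervalIntegral_of_continuous' (f := fun y t ↦
    (fderiv ℝ K (y, t)).comp (ContinuousLinearMap.inl ℝ E ℝ)) ?_ 0 1
  exact (hK.continuous_fderiv one_ne_zero).clm_comp continuous_const

/-- The integral of a `1`-form along the segment from the origin. -/
noncomputable def radialIntegral (η : E → E →L[ℝ] F) (y : E) : F :=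
  ∫ t in (0 : ℝ)..1, η (t • y) y

theorem contDiff_radialIntegrand {η : E → E →L[ℝ] F} (hη : ContDiff ℝ 1 η) :
    ContDiff ℝ 1 fun p : E × ℝ ↦ η (p.2 • p.1) p.1 :=
  (hη.comp (contDiff_snd.smul contDiff_fst)).clm_apply contDiff_fst

theorem contDiff_radialIntegral {η : E → E →L[ℝ] F} (hη : ContDiff ℝ 1 η) :
    ContDiff ℝ 1 (radialIntegral η) :=
  contDiff_one_intervalIntegral (contDiff_radialIntegrand hη)

/-- The homotopy formula for `1`-forms. -/
theorem fderiv_radialIntegral {η : E → E →L[ℝ] F} (hη : ContDiff ℝ 1 η) (y v : E) :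
    fderiv ℝ (radialIntegral η) y v = η y v +
      ∫ t in (0 : ℝ)..1, t • (fderiv ℝ η (t • y) v y - fderiv ℝ η (t • y) y v) := by
  have hd (x : E) : HasFDerivAt η (fderiv ℝ η x) x := (hη.differentiable one_ne_zero x).hasFDerivAt
  have hcd : Continuous (fderiv ℝ η) := hη.continuous_fderiv one_ne_zero
  have hc : Continuous η := hη.continuous
  have hK := contDiff_radialIntegrand hη
  have h1 : fderiv ℝ (radialIntegral η) y v =
      ∫ t in (0 : ℝ)..1, (t • fderiv ℝ η (t • y) v y + η (t • y) v) := by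
    have := (hasFDerivAt_intervalIntegral_of_contDiff hK y).fderiv
    rw [show radialIntegral η = fun x ↦ ∫ t in (0 : ℝ)..1,
      (fun p : E × ℝ ↦ η (p.2 • p.1) p.1) (x, t) from rfl, this,
      ContinuousLinearMap.intervalIntegral_apply]
    · refine integral_congr fun t _ ↦ ?_
      have h2 : HasFDerivAt (fun x : E ↦ η (t • x) x)
          ((fderiv ℝ (fun p : E × ℝ ↦ η (p.2 • p.1) p.1) (y, t)).comp
            (ContinuousLinearMap.inl ℝ E ℝ)) y :=
        HasFDerivAt.comp (g := fun p : E × ℝ ↦ η (p.2 • p.1) p.1) (f := fun x : E ↦ (x, t)) y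
          (hK.differentiable one_ne_zero (y, t)).hasFDerivAt (hasFDerivAt_prodMk_left y t)
      have h3 : HasFDerivAt (fun x : E ↦ η (t • x) x) _ y :=
        (HasFDerivAt.comp (g := η) (f := fun x : E ↦ t • x) y (hd (t • y))
          ((hasFDerivAt_id y).const_smul t)).clm_apply (hasFDerivAt_id y)
      simp only [h2.unique h3]
      simp [add_comm]
    · exact ((((hK.continuous_fderiv one_ne_zero).comp
        (by fun_prop : Continuous fun t : ℝ ↦ (y, t))).clm_comp
        continuous_const).intervalIntegrable _ _)
  -- Fundamental theorem of calculus for t ↦ t η(ty) v, which is 0 at t = 0 and η y v at t = 1.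
  have h4 : η y v = ∫ t in (0 : ℝ)..1, (t • fderiv ℝ η (t • y) y v + η (t • y) v) := by
    rw [integral_eq_sub_of_hasDerivAt (f := fun t : ℝ ↦ t • η (t • y) v)]
    · simp
    · intro t _
      have h5 : HasDerivAt (fun t : ℝ ↦ t • y) y t := by
        simpa using (hasDerivAt_id t).smul_const y
      have h6 : HasDerivAt (fun t : ℝ ↦ η (t • y) v) (fderiv ℝ η (t • y) y v) t := by
        have h7 : HasDerivAt (fun t : ℝ ↦ η (t • y)) (fderiv ℝ η (t • y) y) t :=
          HasFDerivAt.comp_hasDerivAt (l := η) (f := fun t : ℝ ↦ t • y) t (hd (t • y)) h5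
        exact HasFDerivAt.comp_hasDerivAt (l := fun L : E →L[ℝ] F ↦ L v) t
          (ContinuousLinearMap.apply ℝ F v).hasFDerivAt h7
      simpa using (hasDerivAt_id' t).fun_smul h6
    · exact Continuous.intervalIntegrable (by fun_prop) _ _
  have i1 : IntervalIntegrable (fun t : ℝ ↦ t • fderiv ℝ η (t • y) y v + η (t • y) v)
      MeasureTheory.volume 0 1 := Continuous.intervalIntegrable (by fun_prop) _ _
  have i2 : IntervalIntegrable (fun t : ℝ ↦ t • (fderiv ℝ η (t • y) v y - fderiv ℝ η (t • y) y v))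
      MeasureTheory.volume 0 1 := Continuous.intervalIntegrable (by fun_prop) _ _
  rw [h1, h4, ← integral_add i1 i2]
  refine integral_congr fun t _ ↦ ?_
  simp only [smul_sub]
  abel

/-- Picard iteration for the total differential equation `dθ = Γ θ`. -/
noncomputable def picardIterate (Γ : E → E →L[ℝ] X →L[ℝ] X) (x₀ : X) : ℕ → E → X
  | 0 => fun _ ↦ x₀
  | n + 1 => fun y ↦ x₀ + radialIntegral (fun z ↦ (Γ z).flip (picardIterate Γ x₀ n z)) y

variable {Γ : E → E →L[ℝ] X →L[ℝ] X} {x₀ : X}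

theorem contDiff_flip_apply (hΓ : ContDiff ℝ 1 Γ) {θ : E → X} (hθ : ContDiff ℝ 1 θ) :
    ContDiff ℝ 1 fun z ↦ (Γ z).flip (θ z) :=
  let L : (E →L[ℝ] X →L[ℝ] X) →L[ℝ] (X →L[ℝ] E →L[ℝ] X) :=
    (ContinuousLinearMap.flipₗᵢ ℝ E X X).toContinuousLinearEquiv
  have hL : ContDiff ℝ 1 L := ContinuousLinearMap.contDiff L
  (ContDiff.comp (g := L) (f := Γ) hL hΓ).clm_apply hθ

theorem contDiff_picardIterate (hΓ : ContDiff ℝ 1 Γ) (n : ℕ) :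
    ContDiff ℝ 1 (picardIterate Γ x₀ n) := by
  induction n with
  | zero => exact contDiff_const
  | succ n ih => exact contDiff_const.add (contDiff_radialIntegral (contDiff_flip_apply hΓ ih))

theorem fderiv_flip_apply (hΓ : ContDiff ℝ 1 Γ) {θ : E → X} (hθ : ContDiff ℝ 1 θ) (y v w : E) :
    fderiv ℝ (fun z ↦ (Γ z).flip (θ z)) y v w =
      fderiv ℝ Γ y v w (θ y) + Γ y w (fderiv ℝ θ y v) := by
  let L : (E →L[ℝ] X →L[ℝ] X) →L[ℝ] (X →L[ℝ] E →L[ℝ] X) :=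
    (ContinuousLinearMap.flipₗᵢ ℝ E X X).toContinuousLinearEquiv
  have h1 : HasFDerivAt (fun z ↦ (Γ z).flip) (L ∘L fderiv ℝ Γ y) y :=
    HasFDerivAt.comp (g := L) (f := Γ) y L.hasFDerivAt
      (hΓ.differentiable one_ne_zero y).hasFDerivAt
  have h2 := h1.clm_apply (hθ.differentiable one_ne_zero y).hasFDerivAt
  rw [h2.fderiv]
  simp [add_comm, L]

theorem norm_connection_apply_le {M r : ℝ} (hM : ∀ y ∈ ball (0 : E) r, ‖Γ y‖ ≤ M)
    {y : E} (hy : y ∈ ball (0 : E) r) (v : E) (x : X) : ‖Γ y v x‖ ≤ M * ‖v‖ * ‖x‖ :=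
  ((Γ y).le_opNorm₂ v x).trans (by gcongr; exact hM y hy)

theorem smul_mem_ball_zero {r t : ℝ} (ht : t ∈ Set.uIoc (0 : ℝ) 1) {y : E}
    (hy : y ∈ ball (0 : E) r) : t • y ∈ ball (0 : E) r := by
  rw [Set.uIoc_of_le zero_le_one] at ht
  rw [mem_ball_zero_iff] at hy ⊢
  rw [norm_smul, Real.norm_of_nonneg ht.1.le]
  exact (mul_le_of_le_one_left (norm_nonneg _) ht.2).trans_lt hy

/-- On a ball with 8Mr ≤ 1 one Picard step multiplies sup norms by at most Mr ≤ 1/8; the weaker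
factor 1/2 is enough. Flatness plays no role in the convergence, only in identifying the
differential of the limit. -/
theorem norm_picardIterate_succ_sub_le (hΓ : ContDiff ℝ 1 Γ) {M r : ℝ} (hM0 : 0 ≤ M)
    (hM : ∀ y ∈ ball (0 : E) r, ‖Γ y‖ ≤ M) (hMr : 8 * (M * r) ≤ 1) (n : ℕ) :
    ∀ y ∈ ball (0 : E) r,
      ‖picardIterate Γ x₀ (n + 1) y - picardIterate Γ x₀ n y‖ ≤ ‖x₀‖ * (1 / 2) ^ n := by
  have key {θ : E → X} {C : ℝ} (hC : ∀ y ∈ ball (0 : E) r, ‖θ y‖ ≤ C) :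
      ∀ y ∈ ball (0 : E) r, ‖radialIntegral (fun z ↦ (Γ z).flip (θ z)) y‖ ≤ C * (1 / 2) := by
    intro y hy
    have hC0 : 0 ≤ C := (norm_nonneg _).trans (hC y hy)
    have hyr : ‖y‖ ≤ r := (mem_ball_zero_iff.1 hy).le
    refine (norm_integral_le_of_norm_le_const (C := C * (1 / 2)) fun t ht ↦ ?_).trans (by simp)
    have hty := smul_mem_ball_zero ht hy
    refine (norm_connection_apply_le hM hty y _).trans ?_
    calc M * ‖y‖ * ‖θ (t • y)‖ ≤ M * r * C := by
          gcongr
          · exact mul_nonneg hM0 ((norm_nonneg y).trans hyr)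
          · exact hC _ hty
      _ ≤ C * (1 / 2) := by nlinarith
  induction n with
  | zero =>
    intro y hy
    simp only [picardIterate, add_sub_cancel_left, pow_zero, mul_one]
    refine (key (θ := fun _ ↦ x₀) (fun _ _ ↦ le_rfl) y hy).trans ?_
    nlinarith [norm_nonneg x₀]
  | succ n ih =>
    intro y hy
    have hi (m : ℕ) : IntervalIntegrable
        (fun t : ℝ ↦ (Γ (t • y)).flip (picardIterate Γ x₀ m (t • y)) y)
        MeasureTheory.volume 0 1 := by
      have h1 := hΓ.continuous
      have h2 := (contDiff_picardIterate (x₀ := x₀) hΓ m).continuous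
      simp only [ContinuousLinearMap.flip_apply]
      exact Continuous.intervalIntegrable (by fun_prop) _ _
    have h := key ih y hy
    have e : picardIterate Γ x₀ (n + 1 + 1) y - picardIterate Γ x₀ (n + 1) y =
        radialIntegral (fun z ↦ (Γ z).flip
          (picardIterate Γ x₀ (n + 1) z - picardIterate Γ x₀ n z)) y := by
      have e1 (m : ℕ) : picardIterate Γ x₀ (m + 1) y =
        x₀ + radialIntegral (fun z ↦ (Γ z).flip (picardIterate Γ x₀ m z)) y := rfl
      rw [e1, e1, add_sub_add_left_eq_sub, radialIntegral, radialIntegral,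
        ← integral_sub (hi (n + 1)) (hi n), radialIntegral]
      exact integral_congr fun t _ ↦ by simp only [map_sub, sub_apply]
    rw [e, pow_succ, ← mul_assoc]
    exact h

/-- The defect N = dθₙ - Γθₙ decays geometrically. By the homotopy formula, dθₙ₊₁ - Γθₙ is a radial
integral of the exterior derivative of Γθₙ. Flatness cancels the curvature terms there, so only Γ
applied to N remains. This contributes a quarter of the previous bound, and Γ(θₙ - θₙ₊₁) another
quarter. -/
theorem norm_fderiv_picardIterate_sub_le (hΓ : ContDiff ℝ 1 Γ) {M r : ℝ} (hM0 : 0 ≤ M)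
    (hM : ∀ y ∈ ball (0 : E) r, ‖Γ y‖ ≤ M) (hMr : 8 * (M * r) ≤ 1)
    (hflat : ∀ y ∈ ball (0 : E) r, ∀ v w, fderiv ℝ Γ y v w + Γ y w ∘L Γ y v =
      fderiv ℝ Γ y w v + Γ y v ∘L Γ y w) (n : ℕ) :
    ∀ y ∈ ball (0 : E) r, ‖fderiv ℝ (picardIterate Γ x₀ n) y -
      (Γ y).flip (picardIterate Γ x₀ n y)‖ ≤ 4 * M * ‖x₀‖ * (1 / 2) ^ n := by
  induction n with
  | zero =>
    intro y hy
    have : fderiv ℝ (picardIterate Γ x₀ 0) y = 0 := by simp [picardIterate]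
    rw [this, zero_sub, norm_neg, pow_zero, mul_one]
    refine ((Γ y).flip.le_opNorm _).trans ?_
    rw [ContinuousLinearMap.opNorm_flip]
    have := hM y hy
    simp only [picardIterate]
    nlinarith [norm_nonneg x₀, mul_le_mul_of_nonneg_right this (norm_nonneg x₀)]
  | succ n ih =>
    intro y hy
    have hyr : ‖y‖ ≤ r := (mem_ball_zero_iff.1 hy).le
    have hr : 0 ≤ r := (norm_nonneg _).trans hyr
    set θ := picardIterate Γ x₀ n with hθdef
    have hθ : ContDiff ℝ 1 θ := contDiff_picardIterate hΓ n
    set C := 4 * M * ‖x₀‖ * (1 / 2) ^ n with hCdef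
    have hC0 : 0 ≤ C := by positivity
    have h1 : ‖fderiv ℝ (picardIterate Γ x₀ (n + 1)) y - (Γ y).flip (θ y)‖ ≤ C * (1 / 4) := by
      refine ContinuousLinearMap.opNorm_le_bound _ (by positivity) fun v ↦ ?_
      have e : fderiv ℝ (picardIterate Γ x₀ (n + 1)) y =
          fderiv ℝ (radialIntegral (fun z ↦ (Γ z).flip (θ z))) y := by
        simp only [picardIterate]
        rw [fderiv_const_add]
      rw [sub_apply, e,
        fderiv_radialIntegral (contDiff_flip_apply hΓ hθ), add_sub_cancel_left]
      refine (norm_integral_le_of_norm_le_const (C := C * (1 / 4) * ‖v‖) fun t ht ↦ ?_).trans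
        (by simp)
      have hty := smul_mem_ball_zero ht hy
      rw [fderiv_flip_apply hΓ hθ, fderiv_flip_apply hΓ hθ]
      set N := fderiv ℝ θ (t • y) - (Γ (t • y)).flip (θ (t • y)) with hN
      have hNC : ‖N‖ ≤ C := ih _ hty
      have hf := DFunLike.congr_fun (hflat _ hty v y) (θ (t • y))
      simp only [add_apply, ContinuousLinearMap.comp_apply] at hf
      -- Writing dθ = Γθ + N, the terms in θ are the curvature and vanish by `hf`.
      have e2 : fderiv ℝ Γ (t • y) v y (θ (t • y)) + Γ (t • y) y (fderiv ℝ θ (t • y) v) -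
          (fderiv ℝ Γ (t • y) y v (θ (t • y)) + Γ (t • y) v (fderiv ℝ θ (t • y) y)) =
          Γ (t • y) y (N v) - Γ (t • y) v (N y) := by
        simp only [hN, sub_apply, ContinuousLinearMap.flip_apply, map_sub]
        rw [← sub_eq_zero] at hf ⊢
        rw [← hf]
        abel
      rw [e2, norm_smul]
      have ht1 : ‖t‖ ≤ 1 := by
        rw [Set.uIoc_of_le zero_le_one] at ht
        rw [Real.norm_of_nonneg ht.1.le]; exact ht.2
      have b1 : ‖Γ (t • y) y (N v)‖ ≤ M * r * (C * ‖v‖) :=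
        (norm_connection_apply_le hM hty y _).trans (by gcongr; exact N.le_of_opNorm_le hNC v)
      have b2 : ‖Γ (t • y) v (N y)‖ ≤ M * ‖v‖ * (C * r) :=
        (norm_connection_apply_le hM hty v _).trans
          (by gcongr; exact (N.le_of_opNorm_le hNC y).trans (by gcongr))
      calc ‖t‖ * ‖Γ (t • y) y (N v) - Γ (t • y) v (N y)‖
          ≤ 1 * (M * r * (C * ‖v‖) + M * ‖v‖ * (C * r)) := by
            gcongr
            exact (norm_sub_le _ _).trans (add_le_add b1 b2)
        _ = 8 * (M * r) * (C * (1 / 4) * ‖v‖) := by ring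
        _ ≤ 1 * (C * (1 / 4) * ‖v‖) := by gcongr
        _ = _ := one_mul _
    -- The factor 4 in `C` is chosen so that this term, of size M‖x₀‖(1/2)ⁿ, is exactly C/4.
    have h2 : ‖(Γ y).flip (θ y - picardIterate Γ x₀ (n + 1) y)‖ ≤ C * (1 / 4) := by
      refine ((Γ y).flip.le_opNorm _).trans ?_
      rw [ContinuousLinearMap.opNorm_flip, norm_sub_rev]
      calc ‖Γ y‖ * ‖picardIterate Γ x₀ (n + 1) y - θ y‖ ≤ M * (‖x₀‖ * (1 / 2) ^ n) := by
            gcongr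
            · exact hM y hy
            · exact norm_picardIterate_succ_sub_le hΓ hM0 hM hMr n y hy
        _ = C * (1 / 4) := by rw [hCdef]; ring
    calc _ = ‖(fderiv ℝ (picardIterate Γ x₀ (n + 1)) y - (Γ y).flip (θ y)) +
          (Γ y).flip (θ y - picardIterate Γ x₀ (n + 1) y)‖ := by
            rw [map_sub]; congr 1; abel
      _ ≤ C * (1 / 4) + C * (1 / 4) := (norm_add_le _ _).trans (add_le_add h1 h2)
      _ = _ := by rw [hCdef]; ring

/-- Frobenius' theorem for a linear total differential equation: a flat connection has parallel
sections with prescribed value at a point. -/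
theorem exists_hasFDerivAt_connection_of_flat (hΓ : ContDiff ℝ 1 Γ) {R : ℝ} (hR : 0 < R)
    (hflat : ∀ y ∈ ball (0 : E) R, ∀ v w, fderiv ℝ Γ y v w + Γ y w ∘L Γ y v =
      fderiv ℝ Γ y w v + Γ y v ∘L Γ y w) (x₀ : X) :
    ∃ r, 0 < r ∧ r ≤ R ∧ ∃ θ : E → X, θ 0 = x₀ ∧
      ∀ y ∈ ball (0 : E) r, HasFDerivAt θ ((Γ y).flip (θ y)) y := by
  have hcn : Continuous fun y ↦ ‖Γ y‖ := by
    have := hΓ.continuous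
    fun_prop
  obtain ⟨M, hM⟩ := (isCompact_closedBall (0 : E) R).exists_bound_of_continuousOn hcn.continuousOn
  simp only [norm_norm] at hM
  have hM0 : 0 ≤ M := (norm_nonneg _).trans (hM 0 (mem_closedBall_self hR.le))
  -- This secures 8Mr ≤ 1; M + 1 replaces M because M may be 0.
  set r := min R (1 / (8 * (M + 1))) with hr
  have hrR : r ≤ R := min_le_left _ _
  have hr0 : 0 < r := lt_min hR (by positivity)
  have hMr : 8 * (M * r) ≤ 1 := by
    have : r ≤ 1 / (8 * (M + 1)) := min_le_right _ _
    rw [le_div_iff₀ (by positivity)] at this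
    nlinarith
  have hMb : ∀ y ∈ ball (0 : E) r, ‖Γ y‖ ≤ M := fun y hy ↦
    hM y (ball_subset_closedBall (ball_subset_ball hrR hy))
  have hfl : ∀ y ∈ ball (0 : E) r, ∀ v w, fderiv ℝ Γ y v w + Γ y w ∘L Γ y v =
      fderiv ℝ Γ y w v + Γ y v ∘L Γ y w := fun y hy ↦ hflat y (ball_subset_ball hrR hy)
  set p := picardIterate Γ x₀ with hp
  have hd : ∀ y ∈ ball (0 : E) r, ∀ n, dist (p n y) (p (n + 1) y) ≤ ‖x₀‖ * (1 / 2) ^ n := by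
    intro y hy n
    rw [dist_comm, dist_eq_norm]
    exact norm_picardIterate_succ_sub_le hΓ hM0 hMb hMr n y hy
  have hlim : ∀ y ∈ ball (0 : E) r, ∃ x, Tendsto (fun n ↦ p n y) atTop (𝓝 x) := fun y hy ↦
    cauchySeq_tendsto_of_complete (cauchySeq_of_le_geometric (1 / 2) _ (by norm_num) (hd y hy))
  choose! θ hθ using hlim
  refine ⟨r, hr0, hrR, θ, ?_, fun y hy ↦ ?_⟩
  · refine tendsto_nhds_unique (hθ 0 (mem_ball_self hr0)) ?_
    refine tendsto_const_nhds.congr fun n ↦ ?_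
    cases n <;> simp [hp, picardIterate, radialIntegral]
  · refine hasFDerivAt_of_tendstoUniformlyOn (f := p) (f' := fun n y ↦ fderiv ℝ (p n) y)
      (g' := fun y ↦ (Γ y).flip (θ y)) (l := atTop) isOpen_ball ?_ (fun n x _ ↦
      ((contDiff_picardIterate hΓ n).differentiable one_ne_zero x).hasFDerivAt) hθ hy
    rw [Metric.tendstoUniformlyOn_iff]
    intro ε hε
    -- The constant is 6 = 2 + 4: 2 from the distance of the n-th iterate to its limit (tail of the
    -- geometric series), 4 from the defect bound.
    have hz : Tendsto (fun n : ℕ ↦ 6 * M * ‖x₀‖ * (1 / 2 : ℝ) ^ n) atTop (𝓝 0) := by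
      simpa using (tendsto_pow_atTop_nhds_zero_of_lt_one (by norm_num : (0 : ℝ) ≤ 1 / 2)
        (by norm_num)).const_mul (6 * M * ‖x₀‖)
    filter_upwards [hz.eventually (gt_mem_nhds hε)] with n hn y hy
    refine lt_of_le_of_lt ?_ hn
    have h1 := norm_fderiv_picardIterate_sub_le (x₀ := x₀) hΓ hM0 hMb hMr hfl n y hy
    have h2 := dist_le_of_le_geometric_of_tendsto (1 / 2) _ (by norm_num) (hd y hy) (hθ y hy) n
    have h3 : ‖(Γ y).flip (θ y - p n y)‖ ≤ 2 * M * ‖x₀‖ * (1 / 2) ^ n := by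
      refine ((Γ y).flip.le_opNorm _).trans ?_
      rw [ContinuousLinearMap.opNorm_flip, norm_sub_rev, ← dist_eq_norm]
      calc ‖Γ y‖ * dist (p n y) (θ y) ≤ M * (‖x₀‖ * (1 / 2) ^ n / (1 - 1 / 2)) := by
            gcongr
            exact hMb y hy
        _ = _ := by ring
    rw [dist_eq_norm]
    calc _ = ‖(Γ y).flip (θ y - p n y) - (fderiv ℝ (p n) y - (Γ y).flip (p n y))‖ := by
            rw [map_sub]; congr 1; abel
      _ ≤ 2 * M * ‖x₀‖ * (1 / 2) ^ n + 4 * M * ‖x₀‖ * (1 / 2) ^ n :=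
        (norm_sub_le _ _).trans (add_le_add h3 h1)
      _ = _ := by ring

end Frobenius

/-! ### Flat Riemannian metrics are locally Euclidean, and conversely -/

section LeviCivita

set_option linter.unusedSectionVars false
open Metric Filter Topology

variable {E H : Type*} [NormedAddCommGroup E] [NormedSpace ℝ E] [FiniteDimensional ℝ E]
  [NormedAddCommGroup H] [NormedSpace ℝ H] [FiniteDimensional ℝ H]

theorem isInvertible_of_injective_of_finrank_eq {T : E →L[ℝ] H} (hT : Function.Injective T)
    (h : Module.finrank ℝ E = Module.finrank ℝ H) : T.IsInvertible :=
  ⟨(LinearEquiv.ofInjectiveOfFinrankEq T.toLinearMap hT h).toContinuousLinearEquiv, by ext; rfl⟩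

theorem finrank_continuousLinearMap_real : Module.finrank ℝ (E →L[ℝ] ℝ) = Module.finrank ℝ E := by
  rw [← (LinearMap.toContinuousLinearMap (𝕜 := ℝ) (E := E) (F' := ℝ)).finrank_eq]
  exact Subspace.dual_finrank_eq

theorem isInvertible_of_pos {B : E →L[ℝ] E →L[ℝ] ℝ} (hB : ∀ v, v ≠ 0 → 0 < B v v) :
    B.IsInvertible := by
  refine isInvertible_of_injective_of_finrank_eq ?_ finrank_continuousLinearMap_real.symm
  rw [injective_iff_map_eq_zero]
  intro v hv
  by_contra h
  have := hB v h
  simp [hv] at this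

/-- The lowered Christoffel symbols, given by Koszul's formula. -/
noncomputable def koszul (G : E → E →L[ℝ] E →L[ℝ] ℝ) (y : E) : E →L[ℝ] E →L[ℝ] E →L[ℝ] ℝ :=
  (1 / 2 : ℝ) • (fderiv ℝ G y + (fderiv ℝ G y).flip -
    ((ContinuousLinearMap.flipₗᵢ ℝ E E ℝ).toContinuousLinearEquiv :
      (E →L[ℝ] E →L[ℝ] ℝ) →L[ℝ] (E →L[ℝ] E →L[ℝ] ℝ)) ∘L (fderiv ℝ G y).flip)

theorem koszul_apply (G : E → E →L[ℝ] E →L[ℝ] ℝ) (y v w z : E) :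
    koszul G y v w z = (fderiv ℝ G y v w z + fderiv ℝ G y w v z - fderiv ℝ G y z v w) / 2 := by
  simp [koszul]
  ring

/-- The Christoffel symbols as a continuous bilinear map. -/
noncomputable def christoffelCLM (G : E → E →L[ℝ] E →L[ℝ] ℝ) (y : E) : E →L[ℝ] E →L[ℝ] E :=
  (ContinuousLinearMap.compL ℝ E (E →L[ℝ] ℝ) E (G y).inverse) ∘L koszul G y

theorem christoffelCLM_apply (G : E → E →L[ℝ] E →L[ℝ] ℝ) (y v w : E) :
    christoffelCLM G y v w = christoffel G y v w := by
  simp only [christoffelCLM, christoffel, ContinuousLinearMap.comp_apply,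
    ContinuousLinearMap.compL_apply]
  congr 1

theorem metric_christoffelCLM {G : E → E →L[ℝ] E →L[ℝ] ℝ} {y : E} (hG : (G y).IsInvertible)
    (v w : E) : G y (christoffelCLM G y v w) = koszul G y v w := by
  simp only [christoffelCLM, ContinuousLinearMap.comp_apply, ContinuousLinearMap.compL_apply]
  exact hG.self_apply_inverse _

section Smooth

variable {G : E → E →L[ℝ] E →L[ℝ] ℝ} {U : Set E} (hU : IsOpen U)
include hU

theorem contDiffOn_christoffelCLM (hG : ContDiffOn ℝ 2 G U) (hi : ∀ y ∈ U, (G y).IsInvertible) :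
    ContDiffOn ℝ 1 (christoffelCLM G) U := by
  have hD : ContDiffOn ℝ 1 (fderiv ℝ G) U := hG.fderiv_of_isOpen hU (by norm_num)
  have hK : ContDiffOn ℝ 1 (koszul G) U := by
    let T : (E →L[ℝ] E →L[ℝ] E →L[ℝ] ℝ) →L[ℝ] (E →L[ℝ] E →L[ℝ] E →L[ℝ] ℝ) :=
      (ContinuousLinearMap.flipₗᵢ ℝ E E (E →L[ℝ] ℝ)).toContinuousLinearEquiv
    have hT : ContDiffOn ℝ 1 (fun y ↦ (fderiv ℝ G y).flip) U :=
      (T.contDiff.comp_contDiffOn hD : ContDiffOn ℝ 1 (fun y ↦ T (fderiv ℝ G y)) U)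
    exact ((hD.add hT).sub (contDiffOn_const.clm_comp hT)).const_smul (1 / 2 : ℝ)
  have hI : ContDiffOn ℝ 1 (fun y ↦ (G y).inverse) U := fun y hy ↦
    ((hi y hy).contDiffAt_map_inverse).comp_contDiffWithinAt y (hG.of_le (by norm_num) y hy)
  exact ((ContinuousLinearMap.compL ℝ E (E →L[ℝ] ℝ) E).contDiff.comp_contDiffOn hI).clm_comp hK

theorem fderiv_metric_symm (hG : ContDiffOn ℝ 2 G U) (hs : ∀ y ∈ U, ∀ v w, G y v w = G y w v)
    {y : E} (hy : y ∈ U) (z v w : E) : fderiv ℝ G y z v w = fderiv ℝ G y z w v := by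
  have hd : HasFDerivAt G (fderiv ℝ G y) y :=
    ((hG.differentiableOn (by norm_num)).differentiableAt (hU.mem_nhds hy)).hasFDerivAt
  have h (v w : E) : HasFDerivAt (fun x ↦ G x v w) _ y :=
    (hd.clm_apply (hasFDerivAt_const v y)).clm_apply (hasFDerivAt_const w y)
  have he : (fun x ↦ G x v w) =ᶠ[𝓝 y] fun x ↦ G x w v :=
    eventually_of_mem (hU.mem_nhds hy) fun x hx ↦ hs x hx v w
  have := DFunLike.congr_fun ((h v w).unique ((h w v).congr_of_eventuallyEq he)) z
  simpa using this

theorem koszul_symm (hG : ContDiffOn ℝ 2 G U) (hs : ∀ y ∈ U, ∀ v w, G y v w = G y w v)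
    {y : E} (hy : y ∈ U) (v w : E) : koszul G y v w = koszul G y w v := by
  ext z
  rw [koszul_apply, koszul_apply, fderiv_metric_symm hU hG hs hy z v w]
  ring

theorem christoffelCLM_symm (hG : ContDiffOn ℝ 2 G U) (hs : ∀ y ∈ U, ∀ v w, G y v w = G y w v)
    {y : E} (hy : y ∈ U) (v w : E) : christoffelCLM G y v w = christoffelCLM G y w v := by
  simp only [christoffelCLM, ContinuousLinearMap.comp_apply, ContinuousLinearMap.compL_apply,
    koszul_symm hU hG hs hy v w]

/-- Compatibility of the connection with the metric: in the sum of the two Koszul expressions the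
parts antisymmetric in v and w cancel. -/
theorem fderiv_metric_eq (hG : ContDiffOn ℝ 2 G U) (hs : ∀ y ∈ U, ∀ v w, G y v w = G y w v)
    (hi : ∀ y ∈ U, (G y).IsInvertible) {y : E} (hy : y ∈ U) (z v w : E) :
    fderiv ℝ G y z v w = G y (christoffelCLM G y z v) w + G y v (christoffelCLM G y z w) := by
  rw [hs y hy v, metric_christoffelCLM (hi y hy), metric_christoffelCLM (hi y hy), koszul_apply,
    koszul_apply, fderiv_metric_symm hU hG hs hy z w v]
  ring

theorem leviCivitaCurvature_eq (hG : ContDiffOn ℝ 2 G U) (hi : ∀ y ∈ U, (G y).IsInvertible)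
    {y : E} (hy : y ∈ U) (v w z : E) : leviCivitaCurvature G y v w z =
      fderiv ℝ (christoffelCLM G) y v w z - fderiv ℝ (christoffelCLM G) y w v z +
        christoffelCLM G y v (christoffelCLM G y w z) -
          christoffelCLM G y w (christoffelCLM G y v z) := by
  have hd := (((contDiffOn_christoffelCLM hU hG hi).differentiableOn
    one_ne_zero).differentiableAt (hU.mem_nhds hy)).hasFDerivAt
  have h (v w : E) : HasFDerivAt (fun x ↦ christoffelCLM G x v w) _ y :=
    (hd.clm_apply (hasFDerivAt_const v y)).clm_apply (hasFDerivAt_const w y)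
  simp only [leviCivitaCurvature, ← christoffelCLM_apply]
  rw [(h w z).fderiv, (h v z).fderiv]
  simp

end Smooth

/-- A bump function cuts off the locally defined Christoffel symbols, since the Frobenius theorem
above takes a globally C¹ connection. -/
theorem exists_contDiff_eqOn_closedBall {F : Type*} [NormedAddCommGroup F] [NormedSpace ℝ F]
    {f : E → F} {x : E} {R : ℝ} (hR : 0 < R) {n : ℕ} (hf : ContDiffOn ℝ n f (ball x R)) :
    ∃ g : E → F, ContDiff ℝ n g ∧ Set.EqOn g f (closedBall x (R / 3)) := by
  let χ : ContDiffBump x := ⟨R / 3, R / 2, by positivity, by linarith⟩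
  refine ⟨fun y ↦ χ y • f y, contDiff_iff_contDiffAt.2 fun y ↦ ?_, fun y hy ↦ ?_⟩
  · by_cases hy : y ∈ tsupport χ
    · have hy' : y ∈ ball x R := by
        rw [χ.tsupport_eq] at hy
        exact closedBall_subset_ball (by simp only [χ]; linarith) hy
      exact χ.contDiff.contDiffAt.smul (hf.contDiffAt (isOpen_ball.mem_nhds hy'))
    · refine (contDiffAt_const (c := 0)).congr_of_eventuallyEq ?_
      filter_upwards [notMem_tsupport_iff_eventuallyEq.1 hy] with z hz
      simp [hz]
  · simp [χ.one_of_mem_closedBall hy]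

/-- The action of a connection on the tangent space on `H`-valued `1`-forms. -/
noncomputable def coframeConnection (H : Type*) [NormedAddCommGroup H] [NormedSpace ℝ H]
    (Γ : E → E →L[ℝ] E →L[ℝ] E) (y : E) :
    E →L[ℝ] (E →L[ℝ] H) →L[ℝ] (E →L[ℝ] H) :=
  (ContinuousLinearMap.compL ℝ E E H).flip ∘L Γ y

/-- A coframe θ is parallel when dθ = θ ∘ Γ. Precomposition reverses the order of products, so
flatness of the induced connection on forms is flatness of Γ with the quadratic terms in the order
stated here. A translation moves the base point to the origin. -/
theorem exists_parallel_coframe {Γ : E → E →L[ℝ] E →L[ℝ] E} (hΓ : ContDiff ℝ 1 Γ) {R : ℝ}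
    (hR : 0 < R) (x : E)
    (hflat : ∀ y ∈ ball x R, ∀ v w, fderiv ℝ Γ y v w + Γ y v ∘L Γ y w =
      fderiv ℝ Γ y w v + Γ y w ∘L Γ y v) (L₀ : E →L[ℝ] H) :
    ∃ r, 0 < r ∧ r ≤ R ∧ ∃ θ : E → E →L[ℝ] H, θ x = L₀ ∧
      ∀ y ∈ ball x r, HasFDerivAt θ ((ContinuousLinearMap.compL ℝ E E H (θ y)) ∘L Γ y) y := by
  let Γ' : E → E →L[ℝ] (E →L[ℝ] H) →L[ℝ] (E →L[ℝ] H) :=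
    fun y ↦ coframeConnection H Γ (x + y)
  have hΓx : ContDiff ℝ 1 fun y ↦ Γ (x + y) := hΓ.comp (contDiff_const.add contDiff_id)
  have hΓ' : ContDiff ℝ 1 Γ' := contDiff_const.clm_comp hΓx
  have hd (y v : E) : fderiv ℝ Γ' y v =
      (ContinuousLinearMap.compL ℝ E E H).flip ∘L fderiv ℝ Γ (x + y) v := by
    have h1 : HasFDerivAt (fun y ↦ Γ (x + y)) (fderiv ℝ Γ (x + y)) y := by
      rw [hasFDerivAt_comp_add_left]
      exact (hΓ.differentiable one_ne_zero _).hasFDerivAt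
    have h2 := (hasFDerivAt_const (ContinuousLinearMap.compL ℝ E E H).flip y).clm_comp h1
    rw [show fderiv ℝ Γ' y = _ from h2.fderiv]
    simp
  obtain ⟨r, hr, hrR, θ, hθ0, hθ⟩ := exists_hasFDerivAt_connection_of_flat hΓ' hR (fun y hy v w ↦ by
    have hxy : x + y ∈ ball x R := by simpa using hy
    rw [hd, hd]
    ext T u
    have := DFunLike.congr_fun (hflat (x + y) hxy v w) u
    simp only [add_apply, ContinuousLinearMap.comp_apply] at this
    simp only [Γ', coframeConnection, add_apply, ContinuousLinearMap.comp_apply,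
      ContinuousLinearMap.flip_apply, ContinuousLinearMap.compL_apply, ← map_add, this]) L₀
  refine ⟨r, hr, hrR, fun y ↦ θ (y - x), by simpa using hθ0, fun y hy ↦ ?_⟩
  have hy' : y - x ∈ ball (0 : E) r := by simpa [dist_eq_norm] using hy
  have h := hθ (y - x) hy'
  rw [← hasFDerivAt_comp_sub] at h
  convert! h using 1
  ext v u
  simp [Γ', coframeConnection]

/-- Along each segment from the centre the equation becomes a linear ODE for B with zero initial
value, so Grönwall's inequality gives B = 0. -/
theorem bilin_eq_of_connection {B : E → E →L[ℝ] E →L[ℝ] ℝ} {Γ : E → E →L[ℝ] E →L[ℝ] E} {x : E}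
    {r : ℝ} (hΓ : ContinuousOn Γ (ball x r)) (hB : DifferentiableOn ℝ B (ball x r))
    (hd : ∀ y ∈ ball x r, ∀ z v w, fderiv ℝ B y z v w = B y (Γ y z v) w + B y v (Γ y z w))
    (h0 : B x = 0) : ∀ y ∈ ball x r, B y = 0 := by
  intro y hy
  have hmem : ∀ t ∈ Set.Icc (0 : ℝ) 1, x + t • (y - x) ∈ ball x r := by
    intro t ht
    rw [mem_ball_iff_norm] at hy ⊢
    rw [add_sub_cancel_left, norm_smul, Real.norm_of_nonneg ht.1]
    exact (mul_le_of_le_one_left (norm_nonneg _) ht.2).trans_lt hy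
  have hline (t : ℝ) : HasDerivAt (fun t : ℝ ↦ x + t • (y - x)) (y - x) t := by
    simpa using ((hasDerivAt_id t).smul_const (y - x)).const_add x
  have hcl : ContinuousOn (fun t : ℝ ↦ x + t • (y - x)) (Set.Icc 0 1) := by fun_prop
  obtain ⟨M, hM⟩ := (isCompact_Icc (a := (0 : ℝ)) (b := 1)).exists_bound_of_continuousOn
    (hΓ.comp hcl hmem)
  have hM0 : 0 ≤ M := (norm_nonneg _).trans (hM 0 (by simp))
  have hBd (t : ℝ) (ht : t ∈ Set.Icc (0 : ℝ) 1) :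
      HasDerivAt (fun t : ℝ ↦ B (x + t • (y - x))) (fderiv ℝ B (x + t • (y - x)) (y - x)) t :=
    HasFDerivAt.comp_hasDerivAt (l := B) (f := fun t : ℝ ↦ x + t • (y - x)) t
      (hB.differentiableAt (isOpen_ball.mem_nhds (hmem t ht))).hasFDerivAt (hline t)
  have := eq_zero_of_abs_deriv_le_mul_abs_self_of_eq_zero_right
    (f := fun t : ℝ ↦ B (x + t • (y - x))) (f' := fun t ↦ fderiv ℝ B (x + t • (y - x)) (y - x))
    (K := 2 * (M * ‖y - x‖)) (a := 0) (b := 1) (fun t ht ↦ (hBd t ht).continuousAt.continuousWithinAt)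
    (fun t ht ↦ (hBd t ⟨ht.1, ht.2.le⟩).hasDerivWithinAt) (by simpa using h0) (fun t ht ↦ ?_) 1
    (by simp)
  · simpa using this
  have ht' : t ∈ Set.Icc (0 : ℝ) 1 := ⟨ht.1, ht.2.le⟩
  set p := x + t • (y - x) with hp
  refine ContinuousLinearMap.opNorm_le_bound₂ _ (by positivity) fun v w ↦ ?_
  rw [hd p (hmem t ht')]
  have hg (u : E) : ‖Γ p (y - x) u‖ ≤ M * ‖y - x‖ * ‖u‖ :=
    ((Γ p).le_opNorm₂ _ _).trans (by gcongr; exact hM t ht')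
  calc _ ≤ ‖B p (Γ p (y - x) v) w‖ + ‖B p v (Γ p (y - x) w)‖ := norm_add_le _ _
    _ ≤ ‖B p‖ * (M * ‖y - x‖ * ‖v‖) * ‖w‖ + ‖B p‖ * ‖v‖ * (M * ‖y - x‖ * ‖w‖) := by
      refine add_le_add (((B p).le_opNorm₂ _ _).trans ?_) (((B p).le_opNorm₂ _ _).trans ?_)
      · gcongr; exact hg v
      · gcongr; exact hg w
    _ = _ := by ring

/-- A Riemannian metric of vanishing curvature is locally isometric to a vector space with a
constant bilinear form; the isometry has a prescribed differential at a point. -/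
theorem exists_isometry_of_flat {G : E → E →L[ℝ] E →L[ℝ] ℝ} {U : Set E} (hU : IsOpen U) {x : E}
    (hx : x ∈ U) (hG : ContDiffOn ℝ 2 G U) (hs : ∀ y ∈ U, ∀ v w, G y v w = G y w v)
    (hpos : ∀ y ∈ U, ∀ v, v ≠ 0 → 0 < G y v v)
    (hflat : ∀ y ∈ U, ∀ v w z, leviCivitaCurvature G y v w z = 0) (b : H →L[ℝ] H →L[ℝ] ℝ)
    (L₀ : E →L[ℝ] H) (hL₀ : ∀ v w, b (L₀ v) (L₀ w) = G x v w) :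
    ∃ (V : Set E) (F : E → H), IsOpen V ∧ x ∈ V ∧ V ⊆ U ∧ ContDiffOn ℝ 2 F V ∧
      fderiv ℝ F x = L₀ ∧ ∀ y ∈ V, ∀ v w, b (fderiv ℝ F y v) (fderiv ℝ F y w) = G y v w := by
  obtain ⟨R, hR, hRU⟩ := Metric.isOpen_iff.1 hU x hx
  have hi : ∀ y ∈ U, (G y).IsInvertible := fun y hy ↦ isInvertible_of_pos (hpos y hy)
  have hΓ := contDiffOn_christoffelCLM hU hG hi
  obtain ⟨Γ, hΓc, hΓe⟩ := exists_contDiff_eqOn_closedBall (n := 1) hR (hΓ.mono hRU)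
  have hsub : ball x (R / 3) ⊆ U := (ball_subset_ball (by linarith)).trans hRU
  have hev : ∀ y ∈ ball x (R / 3), Γ =ᶠ[𝓝 y] christoffelCLM G := fun y hy ↦
    eventually_of_mem (isOpen_ball.mem_nhds hy) fun z hz ↦ hΓe (ball_subset_closedBall hz)
  obtain ⟨r, hr, hrR, θ, hθ0, hθ⟩ := exists_parallel_coframe hΓc (by positivity : 0 < R / 3) x
    (fun y hy v w ↦ by
      have h1 := fun u ↦ hflat y (hsub hy) v w u
      simp only [leviCivitaCurvature_eq hU hG hi (hsub hy)] at h1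
      rw [(hev y hy).fderiv_eq, (hev y hy).self_of_nhds]
      ext u
      simp only [add_apply, ContinuousLinearMap.comp_apply]
      rw [← sub_eq_zero, ← h1 u]
      abel) L₀
  have hrs : ball x r ⊆ ball x (R / 3) := ball_subset_ball hrR
  have hΓG : ∀ y ∈ ball x r, Γ y = christoffelCLM G y := fun y hy ↦
    (hev y (hrs hy)).self_of_nhds
  -- Symmetry of the Christoffel symbols makes θ closed, so the Poincaré lemma on the ball provides
  -- a primitive.
  obtain ⟨F, hF⟩ := (convex_ball x r).exists_forall_hasFDerivAt_of_fderiv_symmetric isOpen_ball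
    (fun y hy ↦ (hθ y hy).differentiableAt.differentiableWithinAt) (fun y hy v w ↦ by
      rw [(hθ y hy).fderiv]
      simp [hΓG y hy, christoffelCLM_symm hU hG hs (hsub (hrs hy)) v w])
  have hFd : ∀ y ∈ ball x r, fderiv ℝ F y = θ y := fun y hy ↦ (hF y hy).fderiv
  have hθc : ContinuousOn θ (ball x r) := fun y hy ↦ (hθ y hy).continuousAt.continuousWithinAt
  -- Bootstrap: dθ = θ ∘ Γ is continuous because θ and Γ are.
  have hθ1 : ContDiffOn ℝ 1 θ (ball x r) := by
    rw [show (1 : ℕ∞ω) = 0 + 1 from rfl, contDiffOn_succ_iff_fderiv_of_isOpen isOpen_ball]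
    refine ⟨fun y hy ↦ (hθ y hy).differentiableAt.differentiableWithinAt, by simp, ?_⟩
    refine contDiffOn_zero.2 (ContinuousOn.congr ?_ fun y hy ↦ (hθ y hy).fderiv)
    exact ((ContinuousLinearMap.compL ℝ E E H).continuous.comp_continuousOn hθc).clm_comp
      hΓc.continuous.continuousOn
  refine ⟨ball x r, F, isOpen_ball, mem_ball_self hr, hrs.trans hsub, ?_, ?_, fun y hy v w ↦ ?_⟩
  · rw [show (2 : ℕ∞ω) = 1 + 1 from (one_add_one_eq_two).symm,
      contDiffOn_succ_iff_fderiv_of_isOpen isOpen_ball]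
    exact ⟨fun y hy ↦ (hF y hy).differentiableAt.differentiableWithinAt, by simp,
      hθ1.congr hFd⟩
  · rw [hFd x (mem_ball_self hr), hθ0]
  -- The defect θ*b - G is parallel, since both terms are, and it vanishes at x by the choice of L₀.
  · let B : E → E →L[ℝ] E →L[ℝ] ℝ := fun y ↦
      ((ContinuousLinearMap.compL ℝ E H ℝ).flip (θ y) ∘L b) ∘L θ y - G y
    have hBa (y v w : E) : B y v w = b (θ y v) (θ y w) - G y v w := by simp [B]
    have hGd : ∀ y ∈ ball x r, HasFDerivAt G (fderiv ℝ G y) y := fun y hy ↦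
      ((hG.differentiableOn (by norm_num)).differentiableAt
        (hU.mem_nhds (hsub (hrs hy)))).hasFDerivAt
    have hBd : DifferentiableOn ℝ B (ball x r) := by
      have h1 : DifferentiableOn ℝ θ (ball x r) := hθ1.differentiableOn one_ne_zero
      have h2 : DifferentiableOn ℝ (fun y ↦ (ContinuousLinearMap.compL ℝ E H ℝ).flip (θ y))
          (ball x r) := (ContinuousLinearMap.compL ℝ E H ℝ).flip.differentiable.comp_differentiableOn h1
      exact ((h2.clm_comp (differentiableOn_const b)).clm_comp h1).sub
        fun y hy ↦ (hGd y hy).differentiableAt.differentiableWithinAt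
    have hB0 : B y = 0 := by
      refine bilin_eq_of_connection hΓc.continuous.continuousOn hBd (fun p hp z v w ↦ ?_) ?_ y hy
      · have h1 : HasFDerivAt (fun q ↦ B q v w) _ p :=
          (((hBd.differentiableAt (isOpen_ball.mem_nhds hp)).hasFDerivAt.clm_apply
            (hasFDerivAt_const v p)).clm_apply (hasFDerivAt_const w p))
        have h2 (u : E) : HasFDerivAt (fun q ↦ θ q u) _ p :=
          (hθ p hp).clm_apply (hasFDerivAt_const u p)
        have h3 : HasFDerivAt (fun q ↦ b (θ q v) (θ q w) - G q v w) _ p :=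
          ((b.hasFDerivAt.comp p (h2 v)).clm_apply (h2 w)).sub
            (((hGd p hp).clm_apply (hasFDerivAt_const v p)).clm_apply (hasFDerivAt_const w p))
        simp only [hBa] at h1
        have h4 := DFunLike.congr_fun (h1.unique h3) z
        simp only [hBa]
        simp only [add_apply, sub_apply, ContinuousLinearMap.comp_apply,
          ContinuousLinearMap.flip_apply, ContinuousLinearMap.compL_apply, zero_apply,
          map_zero, zero_add, Function.comp_apply] at h4
        rw [h4, fderiv_metric_eq hU hG hs hi (hsub (hrs hp)), hΓG p hp]
        ring
      · ext v w
        rw [hBa, hθ0, hL₀]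
        simp
    have := hBa y v w
    rw [hB0] at this
    rw [hFd y hy]
    simp only [zero_apply] at this
    linarith

/-- The pullback of a constant inner product by a local diffeomorphism is flat. -/
theorem leviCivitaCurvature_pullback_eq_zero {G : E → E →L[ℝ] E →L[ℝ] ℝ} {U : Set E}
    (hU : IsOpen U) {F : E → H} (hF : ContDiffOn ℝ 3 F U) {b : H →L[ℝ] H →L[ℝ] ℝ}
    (hbs : ∀ v w, b v w = b w v) (hbpos : ∀ v, v ≠ 0 → 0 < b v v)
    (hG : ∀ y ∈ U, ∀ v w, G y v w = b (fderiv ℝ F y v) (fderiv ℝ F y w))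
    (hi : ∀ y ∈ U, (fderiv ℝ F y).IsInvertible) {y : E} (hy : y ∈ U) (v w z : E) :
    leviCivitaCurvature G y v w z = 0 := by
  have hF1 : ContDiffOn ℝ 2 (fderiv ℝ F) U := hF.fderiv_of_isOpen hU (by norm_num)
  have hF2 : ContDiffOn ℝ 1 (fderiv ℝ (fderiv ℝ F)) U := hF1.fderiv_of_isOpen hU (by norm_num)
  have hd1 : ∀ y ∈ U, HasFDerivAt (fderiv ℝ F) (fderiv ℝ (fderiv ℝ F) y) y := fun y hy ↦
    ((hF1.differentiableOn (by norm_num)).differentiableAt (hU.mem_nhds hy)).hasFDerivAt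
  have hd2 : ∀ y ∈ U, HasFDerivAt (fderiv ℝ (fderiv ℝ F))
      (fderiv ℝ (fderiv ℝ (fderiv ℝ F)) y) y := fun y hy ↦
    ((hF2.differentiableOn one_ne_zero).differentiableAt (hU.mem_nhds hy)).hasFDerivAt
  have hsym : ∀ y ∈ U, ∀ v w, fderiv ℝ (fderiv ℝ F) y v w = fderiv ℝ (fderiv ℝ F) y w v :=
    fun y hy v w ↦ (hF.contDiffAt (hU.mem_nhds hy)).isSymmSndFDerivAt (by simp; norm_num) v w
  have hsym2 : fderiv ℝ (fderiv ℝ (fderiv ℝ F)) y v w = fderiv ℝ (fderiv ℝ (fderiv ℝ F)) y w v :=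
    (hF1.contDiffAt (hU.mem_nhds hy)).isSymmSndFDerivAt (by simp) v w
  have hGe : ∀ y ∈ U, G y = ((ContinuousLinearMap.compL ℝ E H ℝ).flip (fderiv ℝ F y) ∘L b) ∘L
      fderiv ℝ F y := fun y hy ↦ by ext v w; simp [hG y hy]
  have hGd : DifferentiableOn ℝ G U := by
    have h1 : DifferentiableOn ℝ (fderiv ℝ F) U := hF1.differentiableOn (by norm_num)
    have h2 : DifferentiableOn ℝ (fun y ↦ (ContinuousLinearMap.compL ℝ E H ℝ).flip (fderiv ℝ F y)) U :=
      (ContinuousLinearMap.compL ℝ E H ℝ).flip.differentiable.comp_differentiableOn h1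
    exact ((h2.clm_comp (differentiableOn_const b)).clm_comp h1).congr hGe
  have hGD : ∀ y ∈ U, ∀ z v w, fderiv ℝ G y z v w =
      b (fderiv ℝ (fderiv ℝ F) y z v) (fderiv ℝ F y w) +
        b (fderiv ℝ F y v) (fderiv ℝ (fderiv ℝ F) y z w) := by
    intro y hy z v w
    have h1 : HasFDerivAt (fun q ↦ G q v w) _ y :=
      ((hGd.differentiableAt (hU.mem_nhds hy)).hasFDerivAt.clm_apply
        (hasFDerivAt_const v y)).clm_apply (hasFDerivAt_const w y)
    have h2 (u : E) : HasFDerivAt (fun q ↦ fderiv ℝ F q u) _ y :=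
      (hd1 y hy).clm_apply (hasFDerivAt_const u y)
    have h3 : HasFDerivAt (fun q ↦ b (fderiv ℝ F q v) (fderiv ℝ F q w)) _ y :=
      (b.hasFDerivAt.comp y (h2 v)).clm_apply (h2 w)
    have h4 := DFunLike.congr_fun (h1.unique (h3.congr_of_eventuallyEq
      (eventually_of_mem (hU.mem_nhds hy) fun q hq ↦ hG q hq v w))) z
    simpa [add_comm] using h4
  have hGi : ∀ y ∈ U, (G y).IsInvertible := fun y hy ↦ isInvertible_of_pos fun v hv ↦ by
    rw [hG y hy]
    refine hbpos _ fun h ↦ hv ?_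
    exact (hi y hy).injective (h.trans (map_zero _).symm)
  -- In the flat coordinates F the Christoffel symbols vanish, which pulls back to dF(Γ(v, w)) =
  -- D²F(v, w). If the difference q were nonzero, testing Koszul's formula against the preimage u of
  -- q would give b(q, q) = 0.
  have hΓ : ∀ y ∈ U, ∀ v w, fderiv ℝ F y (christoffel G y v w) = fderiv ℝ (fderiv ℝ F) y v w := by
    intro y hy v w
    rw [← sub_eq_zero]
    by_contra hne
    obtain ⟨u, hu⟩ := (hi y hy).surjective
      (fderiv ℝ F y (christoffel G y v w) - fderiv ℝ (fderiv ℝ F) y v w)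
    have h1 := DFunLike.congr_fun (metric_christoffelCLM (hGi y hy) v w) u
    rw [christoffelCLM_apply, hG y hy, koszul_apply, hGD y hy, hGD y hy, hGD y hy, hu] at h1
    have h2 := hbpos _ hne
    rw [hsym y hy w v, hsym y hy u v, hsym y hy u w, hbs (fderiv ℝ F y v),
      hbs (fderiv ℝ F y w)] at h1
    set q := fderiv ℝ F y (christoffel G y v w) - fderiv ℝ (fderiv ℝ F) y v w with hq
    have h3 : b q q = b (fderiv ℝ F y (christoffel G y v w)) q - b (fderiv ℝ (fderiv ℝ F) y v w) q := by
      rw [← sub_apply, ← map_sub, ← hq]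
    rw [h3, h1] at h2
    linarith
  have hΓe : ∀ y ∈ U, ∀ v w,
      christoffel G y v w = (fderiv ℝ F y).inverse (fderiv ℝ (fderiv ℝ F) y v w) := fun y hy v w ↦ by
    rw [← hΓ y hy, (hi y hy).inverse_apply_self]
  have hΓd (w z : E) : DifferentiableAt ℝ (fun x ↦ christoffel G x w z) y := by
    have h1 : DifferentiableAt ℝ (fun x ↦ (fderiv ℝ F x).inverse (fderiv ℝ (fderiv ℝ F) x w z)) y := by
      have h2 : DifferentiableAt ℝ (fun x ↦ (fderiv ℝ F x).inverse) y :=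
        DifferentiableAt.comp y (((hi y hy).contDiffAt_map_inverse (n := 1)).differentiableAt
          one_ne_zero) (hd1 y hy).differentiableAt
      exact h2.clm_apply (((hd2 y hy).differentiableAt.clm_apply
        (differentiableAt_const w)).clm_apply (differentiableAt_const z))
    exact h1.congr_of_eventuallyEq (eventually_of_mem (hU.mem_nhds hy) fun x hx ↦ hΓe x hx w z)
  -- Differentiating the identity `hΓ` expresses dF of the derivative of Γ through D³F and D²F. In
  -- the curvature, D³F cancels by symmetry and the D²F terms cancel against the quadratic ones.
  have key (v w z : E) : fderiv ℝ F y (fderiv ℝ (fun x ↦ christoffel G x w z) y v) =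
      fderiv ℝ (fderiv ℝ (fderiv ℝ F)) y v w z -
        fderiv ℝ (fderiv ℝ F) y v (christoffel G y w z) := by
    have h1 : HasFDerivAt (fun x ↦ fderiv ℝ F x (christoffel G x w z)) _ y :=
      (hd1 y hy).clm_apply (hΓd w z).hasFDerivAt
    have h2 : HasFDerivAt (fun x ↦ fderiv ℝ (fderiv ℝ F) x w z) _ y :=
      ((hd2 y hy).clm_apply (hasFDerivAt_const w y)).clm_apply (hasFDerivAt_const z y)
    have h3 := DFunLike.congr_fun (h1.unique (h2.congr_of_eventuallyEq
      (eventually_of_mem (hU.mem_nhds hy) fun x hx ↦ hΓ x hx w z))) v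
    simp only [add_apply, ContinuousLinearMap.comp_apply,
          ContinuousLinearMap.flip_apply, zero_apply,
          map_zero, zero_add] at h3
    rw [← h3]
    abel
  refine (hi y hy).injective ?_
  rw [leviCivitaCurvature, map_sub, map_add, map_sub, key, key, hΓ y hy, hΓ y hy, hsym2, map_zero]
  abel

end LeviCivita

/-! ### Holomorphic functions of several variables are smooth -/

section SeveralVariables

open Metric Filter Topology MeasureTheory

variable {E : Type*} [NormedAddCommGroup E] [NormedSpace ℂ E] [FiniteDimensional ℂ E]

/-- The partial derivatives of a holomorphic function of several variables are holomorphic. -/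
theorem differentiableOn_fderiv_apply_complex {f : E → ℂ} {U : Set E} (hU : IsOpen U)
    (hf : DifferentiableOn ℂ f U) (e : E) :
    DifferentiableOn ℂ (fun z ↦ fderiv ℂ f z e) U := by
  intro x hx
  refine DifferentiableAt.differentiableWithinAt ?_
  obtain ⟨R, hR, hRU, hRf⟩ : ∃ R > 0, ball x (3 * R) ⊆ U ∧
      ∀ z ∈ ball x (3 * R), f z ∈ ball (f x) 1 := by
    have h1 : ∀ᶠ z in 𝓝 x, z ∈ U ∧ f z ∈ ball (f x) 1 :=
      (hU.eventually_mem hx).and ((hf.differentiableAt (hU.mem_nhds hx)).continuousAt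
        (ball_mem_nhds _ one_pos))
    obtain ⟨ε, hε, h⟩ := Metric.eventually_nhds_iff_ball.1 h1
    refine ⟨ε / 3, by positivity, fun z hz ↦ (h z ?_).1, fun z hz ↦ (h z ?_).2⟩ <;>
      simpa [mul_div_cancel₀] using hz
  have hd : ∀ z ∈ ball x (3 * R), HasFDerivAt f (fderiv ℂ f z) z := fun z hz ↦
    (hf.differentiableAt (hU.mem_nhds (hRU hz))).hasFDerivAt
  -- A Cauchy estimate: f varies by less than 2 on balls of radius R. It supplies the dominating
  -- function for differentiation under the integral.
  have hbound : ∀ z ∈ ball x (2 * R), ‖fderiv ℂ f z‖ ≤ 2 / R := by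
    intro z hz
    have hsub : ball z R ⊆ ball x (3 * R) := ball_subset_ball' (by
      rw [mem_ball] at hz; linarith)
    refine Complex.norm_fderiv_le_div_of_mapsTo_ball (hf.mono (hsub.trans hRU)) (fun w hw ↦ ?_) hR
    have h1 := hRf w (hsub hw)
    have h2 := hRf z (hsub (mem_ball_self hR))
    rw [mem_ball] at h1 h2
    rw [mem_closedBall]
    linarith [dist_triangle_right (f w) (f z) (f x)]
  -- The radius is chosen so that the disc z + ζe, |ζ| ≤ ρ, stays within distance R of z, even when
  -- e = 0.
  set ρ : ℝ := R / (‖e‖ + 1) with hρ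
  have hρ0 : 0 < ρ := by positivity
  have hρe {ζ : ℂ} (hζ : ‖ζ‖ ≤ ρ) : ‖ζ • e‖ < R := by
    rw [norm_smul]
    calc ‖ζ‖ * ‖e‖ ≤ ρ * ‖e‖ := by gcongr
      _ < ρ * (‖e‖ + 1) := by gcongr; linarith
      _ = R := by rw [hρ]; field_simp
  have hmem {z : E} {ζ : ℂ} {s : ℝ} (hz : z ∈ ball x s) (hζ : ‖ζ‖ ≤ ρ) :
      z + ζ • e ∈ ball x (s + R) := by
    rw [mem_ball_iff_norm] at hz ⊢
    calc ‖z + ζ • e - x‖ = ‖(z - x) + ζ • e‖ := by congr 1; abel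
      _ ≤ ‖z - x‖ + ‖ζ • e‖ := norm_add_le _ _
      _ < s + R := add_lt_add hz (hρe hζ)
  have hγ (t : ℝ) : ‖circleMap 0 ρ t‖ ≤ ρ := by simp [abs_of_pos hρ0]
  let c : ℝ → ℂ := fun t ↦ deriv (circleMap 0 ρ) t * ((circleMap 0 ρ t - 0) ^ 2)⁻¹
  have hne (t : ℝ) : circleMap 0 ρ t ≠ 0 := circleMap_ne_center hρ0.ne'
  have hc : Continuous c := by
    have h1 : Continuous (circleMap 0 ρ) := continuous_circleMap 0 ρ
    simp only [c, deriv_circleMap, sub_zero]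
    exact (h1.mul continuous_const).mul ((h1.pow 2).inv₀ fun t ↦ pow_ne_zero 2 (hne t))
  have hcb (t : ℝ) : ‖c t‖ ≤ ρ⁻¹ := by
    simp only [c, deriv_circleMap, sub_zero, norm_mul, norm_inv, norm_pow, norm_circleMap_zero,
      Complex.norm_I, abs_of_pos hρ0]
    apply le_of_eq
    field_simp
  -- Cauchy's formula for the derivative on the complex line through z in direction e. On the right
  -- z enters only through values of f, so that side can be differentiated in z.
  have hint : ∀ z ∈ ball x R, fderiv ℂ f z e =
      (2 * Real.pi * Complex.I : ℂ)⁻¹ • ∫ t in (0 : ℝ)..2 * Real.pi,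
        c t • f (z + circleMap 0 ρ t • e) := by
    intro z hz
    have hline (ζ : ℂ) : HasDerivAt (fun ζ : ℂ ↦ z + ζ • e) e ζ := by
      simpa using ((hasDerivAt_id ζ).smul_const e).const_add z
    have hlc : Continuous fun ζ : ℂ ↦ z + ζ • e := by fun_prop
    have hV : IsOpen ((fun ζ : ℂ ↦ z + ζ • e) ⁻¹' ball x (3 * R)) := isOpen_ball.preimage hlc
    have hfl : ∀ ζ, z + ζ • e ∈ ball x (3 * R) →
        HasDerivAt (fun ζ : ℂ ↦ f (z + ζ • e)) (fderiv ℂ f (z + ζ • e) e) ζ := fun ζ hζ ↦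
      HasFDerivAt.comp_hasDerivAt (l := f) (f := fun ζ : ℂ ↦ z + ζ • e) ζ (hd _ hζ) (hline ζ)
    have h := Complex.two_pi_I_inv_smul_circleIntegral_sub_sq_inv_smul_of_differentiable hV
      (c := 0) (w₀ := 0) (R := ρ) (f := fun ζ : ℂ ↦ f (z + ζ • e))
      (fun ζ hζ ↦ ball_subset_ball (by linarith) (hmem hz (mem_closedBall_zero_iff.1 hζ)))
      (fun ζ hζ ↦ (hfl ζ hζ).differentiableAt.differentiableWithinAt) (mem_ball_self hρ0)
    have hz3 : z + (0 : ℂ) • e ∈ ball x (3 * R) := by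
      simpa using ball_subset_ball (by linarith) hz
    have h0 := (hfl 0 hz3).deriv
    rw [zero_smul, add_zero] at h0
    rw [← h0, ← h]
    congr 1
    rw [circleIntegral]
    refine intervalIntegral.integral_congr fun t _ ↦ ?_
    simp only [c, smul_smul]
  have hev : (fun z ↦ fderiv ℂ f z e) =ᶠ[𝓝 x] fun z ↦ (2 * Real.pi * Complex.I : ℂ)⁻¹ •
      ∫ t in (0 : ℝ)..2 * Real.pi, c t • f (z + circleMap 0 ρ t • e) :=
    eventually_of_mem (ball_mem_nhds x hR) hint
  refine DifferentiableAt.congr_of_eventuallyEq (DifferentiableAt.fun_const_smul ?_ _) hev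
  borelize E
  have : ProperSpace E := FiniteDimensional.proper ℂ E
  have : ProperSpace (E →L[ℂ] ℂ) := FiniteDimensional.proper ℂ _
  have hγc : Continuous fun t : ℝ ↦ circleMap 0 ρ t • e :=
    (continuous_circleMap 0 ρ).smul continuous_const
  have hFc : ∀ z ∈ ball x R, Continuous fun t ↦ c t • f (z + circleMap 0 ρ t • e) := by
    intro z hz
    refine hc.smul (continuous_iff_continuousAt.2 fun t ↦ ?_)
    refine ContinuousAt.comp (g := f) (f := fun t : ℝ ↦ z + circleMap 0 ρ t • e) ?_
      (by fun_prop)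
    exact (hd _ (ball_subset_ball (by linarith) (hmem hz (hγ t)))).continuousAt
  refine (intervalIntegral.hasFDerivAt_integral_of_dominated_of_fderiv_le (𝕜 := ℂ)
    (F := fun z t ↦ c t • f (z + circleMap 0 ρ t • e))
    (F' := fun z t ↦ c t • fderiv ℂ f (z + circleMap 0 ρ t • e)) (bound := fun _ ↦ ρ⁻¹ * (2 / R))
    (ball_mem_nhds x hR) ?_ ((hFc x (mem_ball_self hR)).intervalIntegrable _ _) ?_ ?_
    intervalIntegrable_const ?_).differentiableAt
  · exact eventually_of_mem (ball_mem_nhds x hR) fun z hz ↦ (hFc z hz).aestronglyMeasurable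
  -- Continuity of the derivative is not yet known here; measurability holds for the derivative of
  -- any function and is enough.
  · have h1 : Measurable fun t : ℝ ↦ fderiv ℂ f (x + circleMap 0 ρ t • e) :=
      (measurable_fderiv ℂ f).comp (by fun_prop : Continuous fun t : ℝ ↦
        x + circleMap 0 ρ t • e).measurable
    exact (hc.measurable.smul h1).aestronglyMeasurable
  · refine Eventually.of_forall fun t _ z hz ↦ ?_
    rw [norm_smul]
    gcongr
    · exact hcb t
    · exact hbound _ (ball_subset_ball (by linarith) (hmem hz (hγ t)))
  · refine Eventually.of_forall fun t _ z hz ↦ ?_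
    have h1 : z + circleMap 0 ρ t • e ∈ ball x (3 * R) :=
      ball_subset_ball (by linarith) (hmem hz (hγ t))
    have h2 : HasFDerivAt (fun z ↦ f (z + circleMap 0 ρ t • e)) _ z :=
      (hasFDerivAt_comp_add_right (circleMap 0 ρ t • e)).2 (hd _ h1)
    exact h2.const_smul (c t)

/-- A holomorphic function of several variables is smooth. -/
theorem contDiffOn_of_differentiableOn_complex {U : Set E} (hU : IsOpen U) (n : ℕ) {f : E → ℂ}
    (hf : DifferentiableOn ℂ f U) : ContDiffOn ℂ n f U := by
  induction n generalizing f with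
  | zero => exact contDiffOn_zero.2 hf.continuousOn
  | succ n ih =>
    rw [Nat.cast_succ, contDiffOn_succ_iff_fderiv_apply hU.uniqueDiffOn]
    refine ⟨hf, fun h ↦ absurd h (by simp), fun e ↦ ?_⟩
    refine (ih (differentiableOn_fderiv_apply_complex hU hf e)).congr fun z hz ↦ ?_
    rw [fderivWithin_of_isOpen hU hz]

end SeveralVariables

/-! ### Linear algebra of the coframe and of Hermitian forms -/

section ComplexLinear

open ComplexConjugate

/-- The Euclidean inner product of `ℂ × ℂ`. -/
noncomputable def euclideanForm : ℂ × ℂ →L[ℝ] ℂ × ℂ →L[ℝ] ℝ :=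
  (innerSL ℝ : ℂ →L[ℝ] ℂ →L[ℝ] ℝ).bilinearComp (.fst ℝ ℂ ℂ) (.fst ℝ ℂ ℂ) +
    (innerSL ℝ : ℂ →L[ℝ] ℂ →L[ℝ] ℝ).bilinearComp (.snd ℝ ℂ ℂ) (.snd ℝ ℂ ℂ)

theorem euclideanForm_apply (x y : ℂ × ℂ) :
    euclideanForm x y = (x.1 * conj y.1).re + (x.2 * conj y.2).re := by
  simp [euclideanForm, Complex.inner, mul_comm]

theorem euclideanForm_comm (x y : ℂ × ℂ) : euclideanForm x y = euclideanForm y x := by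
  simp only [euclideanForm_apply, Complex.mul_re, Complex.conj_re, Complex.conj_im]
  ring

theorem euclideanForm_self (x : ℂ × ℂ) : euclideanForm x x = ‖x.1‖ ^ 2 + ‖x.2‖ ^ 2 := by
  simp [euclideanForm_apply, Complex.mul_conj, Complex.normSq_eq_norm_sq, -Complex.ofReal_pow]

theorem euclideanForm_pos (x : ℂ × ℂ) (hx : x ≠ 0) : 0 < euclideanForm x x := by
  rw [euclideanForm_self]
  by_contra h
  refine hx (Prod.ext ?_ ?_)
  · have : ‖x.1‖ ^ 2 = 0 := by nlinarith [sq_nonneg ‖x.1‖, sq_nonneg ‖x.2‖]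
    simpa using this
  · have : ‖x.2‖ ^ 2 = 0 := by nlinarith [sq_nonneg ‖x.1‖, sq_nonneg ‖x.2‖]
    simpa using this

/-- `φ₁(v) conj φ₁(w) + conj φ₁(v) φ₁(w) + φ₂(v) conj φ₂(w) + conj φ₂(v) φ₂(w)` in terms of the
values of the forms. -/
theorem coframe_sum_eq {f a b a' b' : ℂ} {s : ℝ} (hs : s ^ 2 * (2 * (1 + ‖f‖ ^ 2)) = 1) :
    (s * (a - Complex.I * f * conj b)) * conj (s * (a' - Complex.I * f * conj b')) +
      conj (s * (a - Complex.I * f * conj b)) * (s * (a' - Complex.I * f * conj b')) +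
      ((s * (b + Complex.I * f * conj a)) * conj (s * (b' + Complex.I * f * conj a')) +
      conj (s * (b + Complex.I * f * conj a)) * (s * (b' + Complex.I * f * conj a'))) =
    ((euclideanForm (a, b) (a', b') : ℝ) : ℂ) := by
  have hre (z : ℂ) : ((z.re : ℝ) : ℂ) = (z + conj z) / 2 := Complex.re_eq_add_conj z
  have hs' : (s : ℂ) ^ 2 * (2 * (1 + f * conj f)) = 1 := by
    rw [Complex.mul_conj, Complex.normSq_eq_norm_sq]
    exact_mod_cast hs
  rw [euclideanForm_apply, Complex.ofReal_add, hre, hre]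
  simp only [map_mul, map_sub, map_add, Complex.conj_conj, Complex.conj_I, Complex.conj_ofReal]
  have hI := Complex.I_sq
  linear_combination (a * conj a' + conj a * a' + b * conj b' + conj b * b') / 2 * hs' -
    s ^ 2 * f * conj f * (a * conj a' + conj a * a' + b * conj b' + conj b * b') * hI

/-- The coefficient i conj v - u conj f equals iλ conj B, so the df term cancels the one hidden in
du. -/
theorem coframe_one_eq {u v f A B a b df du : ℂ} {s l : ℝ} (hl : l = 1 + ‖f‖ ^ 2) (hl0 : l ≠ 0)
    (hu : u = A - Complex.I * f * conj B) (hv : v = B + Complex.I * f * conj A)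
    (hdu : du = a - Complex.I * (df * conj B + f * conj b)) :
    s * du + ((s / l : ℝ) * (Complex.I * conj v - u * conj f)) * df =
      s * (a - Complex.I * f * conj b) := by
  have hl' : (l : ℂ) = 1 + f * conj f := by
    rw [Complex.mul_conj, Complex.normSq_eq_norm_sq, hl]
    push_cast; rfl
  have hlc : (l : ℂ) ≠ 0 := Complex.ofReal_ne_zero.2 hl0
  have h : Complex.I * conj v - u * conj f = Complex.I * conj B * l := by
    rw [hl', hu, hv]
    simp only [map_mul, map_add, Complex.conj_conj, Complex.conj_I]
    linear_combination (- conj f * A) * Complex.I_sq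
  rw [h, hdu]
  push_cast
  field_simp
  ring

theorem coframe_two_eq {u v f A B a b df dv : ℂ} {s l : ℝ} (hl : l = 1 + ‖f‖ ^ 2) (hl0 : l ≠ 0)
    (hu : u = A - Complex.I * f * conj B) (hv : v = B + Complex.I * f * conj A)
    (hdv : dv = b + Complex.I * (df * conj A + f * conj a)) :
    s * dv - ((s / l : ℝ) * (Complex.I * conj u + v * conj f)) * df =
      s * (b + Complex.I * f * conj a) := by
  have hl' : (l : ℂ) = 1 + f * conj f := by
    rw [Complex.mul_conj, Complex.normSq_eq_norm_sq, hl]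
    push_cast; rfl
  have hlc : (l : ℂ) ≠ 0 := Complex.ofReal_ne_zero.2 hl0
  have h : Complex.I * conj u + v * conj f = Complex.I * conj A * l := by
    rw [hl', hu, hv]
    simp only [map_mul, map_sub, Complex.conj_conj, Complex.conj_I]
    linear_combination (conj f * B) * Complex.I_sq
  rw [h, hdv]
  push_cast
  field_simp
  ring

section Forms

variable {V : Type*} [AddCommGroup V] [Module ℂ V]

/-- Cramer's rule shows that (φ, ψ) maps onto ℂ², and equality of dimensions makes it injective. -/
theorem eq_zero_of_forms_wedge_ne_zero (hV : Module.finrank ℂ V = 2) {φ ψ : V →ₗ[ℂ] ℂ} {v w : V}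
    (h : φ v * ψ w - φ w * ψ v ≠ 0) {z : V} (h1 : φ z = 0) (h2 : ψ z = 0) : z = 0 := by
  have : FiniteDimensional ℂ V := Module.finite_of_finrank_eq_succ hV
  have hs : Function.Surjective (φ.prod ψ) := by
    rintro ⟨a, b⟩
    refine ⟨((a * ψ w - b * φ w) / (φ v * ψ w - φ w * ψ v)) • v +
      ((b * φ v - a * ψ v) / (φ v * ψ w - φ w * ψ v)) • w, ?_⟩
    refine Prod.ext ?_ ?_ <;>
      simp only [LinearMap.prod_apply, Function.prod_apply, map_add, map_smul, smul_eq_mul,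
        Prod.fst_add, Prod.snd_add, Prod.smul_fst, Prod.smul_snd] <;>
      rw [div_mul_eq_mul_div, div_mul_eq_mul_div, ← add_div, div_eq_iff h] <;> ring
  have hi := (LinearMap.injective_iff_surjective_of_finrank_eq_finrank
    (by simp [hV] : Module.finrank ℂ V = Module.finrank ℂ (ℂ × ℂ))).2 hs
  exact hi (by simp [h1, h2])

theorem forms_basis_of_injective (hV : Module.finrank ℂ V = 2) {φ ψ : V →ₗ[ℂ] ℂ}
    (h : ∀ z, φ z = 0 → ψ z = 0 → z = 0) :
    (∃ e, φ e = 1 ∧ ψ e = 0) ∧ (∃ e, φ e = 0 ∧ ψ e = 1) := by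
  have : FiniteDimensional ℂ V := Module.finite_of_finrank_eq_succ hV
  have hi : Function.Injective (φ.prod ψ) := by
    rw [injective_iff_map_eq_zero]
    intro z hz
    exact h z (congrArg Prod.fst hz) (congrArg Prod.snd hz)
  have hs := (LinearMap.injective_iff_surjective_of_finrank_eq_finrank
    (by simp [hV] : Module.finrank ℂ V = Module.finrank ℂ (ℂ × ℂ))).1 hi
  obtain ⟨e, he⟩ := hs (1, 0)
  obtain ⟨e', he'⟩ := hs (0, 1)
  exact ⟨⟨e, congrArg Prod.fst he, congrArg Prod.snd he⟩,
    ⟨e', congrArg Prod.fst he', congrArg Prod.snd he'⟩⟩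

/-- A J-invariant inner product g is the real part of the Hermitian product g(v, w) - i g(v, iw),
and p, q are the coordinates in an orthonormal basis. They are normalised to match `euclideanForm`,
hence are √2 times a unitary coframe in the sense of the theorem. -/
theorem exists_unitary_coframe (hV : Module.finrank ℂ V = 2) (g : V →ₗ[ℝ] V →ₗ[ℝ] ℝ)
    (hs : ∀ v w, g v w = g w v) (hpos : ∀ v, v ≠ 0 → 0 < g v v)
    (hJ : ∀ v w, g (Complex.I • v) (Complex.I • w) = g v w) :
    ∃ p q : V →ₗ[ℂ] ℂ, ∀ v w, g v w = (p v * conj (p w)).re + (q v * conj (q w)).re := by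
  have : FiniteDimensional ℂ V := Module.finite_of_finrank_eq_succ hV
  have hII (v : V) : Complex.I • Complex.I • v = -v := by
    rw [smul_smul, Complex.I_mul_I, neg_one_smul]
  have hJ1 (v w : V) : g (Complex.I • v) w = -g v (Complex.I • w) := by
    rw [← hJ v, hII]
    simp
  have hc (c : ℂ) (v : V) : c • v = c.re • v + c.im • (Complex.I • v) := by
    conv_lhs => rw [← Complex.re_add_im c, add_smul, mul_smul]
    rfl
  let core : InnerProductSpace.Core ℂ V :=
    { inner := fun v w ↦ ⟨g v w, -g v (Complex.I • w)⟩
      conj_inner_symm := fun v w ↦ by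
        apply Complex.ext
        · simp [hs v w]
        · simp only [Complex.conj_im, neg_neg]
          rw [← hJ1, hs]
      re_inner_nonneg := fun v ↦ by
        change 0 ≤ g v v
        by_cases hv : v = 0
        · simp [hv]
        · exact (hpos v hv).le
      add_left := fun u v w ↦ by
        apply Complex.ext
        · simp
        · simp; ring
      smul_left := fun v w r ↦ by
        apply Complex.ext
        · simp [hc r v, hJ1, sub_eq_add_neg]
        · simp [hc r v, hJ1, hII]
          ring
      definite := fun v hv ↦ by
        by_contra h
        have := hpos v h
        have h2 : g v v = 0 := congrArg Complex.re hv
        linarith }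
  let _ : NormedAddCommGroup V := core.toNormedAddCommGroup
  let _ : InnerProductSpace ℂ V := InnerProductSpace.ofCore core.toCore
  have hin (v w : V) : (inner ℂ v w : ℂ).re = g v w := rfl
  let o := (stdOrthonormalBasis ℂ V).reindex (finCongr hV)
  refine ⟨(innerSL ℂ (o 0)).toLinearMap, (innerSL ℂ (o 1)).toLinearMap, fun v w ↦ ?_⟩
  have h := o.sum_inner_mul_inner w v
  rw [hs, ← hin, ← h, Fin.sum_univ_two]
  simp [mul_comm]

end Forms

end ComplexLinear

/-! ### Types (1,0) and (0,1), and the twistor coordinate -/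

section DolbeaultParts

open ComplexConjugate Filter Topology

variable {E : Type*} [NormedAddCommGroup E] [NormedSpace ℂ E]

/-- Multiplication by `i`, as a real-linear map. -/
noncomputable def mulI (E : Type*) [NormedAddCommGroup E] [NormedSpace ℂ E] : E →L[ℝ] E :=
  (Complex.I • ContinuousLinearMap.id ℂ E).restrictScalars ℝ

@[simp] theorem mulI_apply (v : E) : mulI E v = Complex.I • v := rfl

/-- Twice the complex linear part of a real-linear form. -/
noncomputable def linPart (h : E →L[ℝ] ℂ) : E →L[ℝ] ℂ := h - Complex.I • h ∘L mulI E

/-- Twice the complex antilinear part of a real-linear form. -/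
noncomputable def antiPart (h : E →L[ℝ] ℂ) : E →L[ℝ] ℂ := h + Complex.I • h ∘L mulI E

theorem linPart_apply (h : E →L[ℝ] ℂ) (v : E) :
    linPart h v = h v - Complex.I * h (Complex.I • v) := rfl

theorem antiPart_apply (h : E →L[ℝ] ℂ) (v : E) :
    antiPart h v = h v + Complex.I * h (Complex.I • v) := rfl

theorem smul_eq_re_add_im (c : ℂ) (v : E) : c • v = c.re • v + c.im • (Complex.I • v) := by
  conv_lhs => rw [← Complex.re_add_im c, add_smul, mul_smul]
  rfl

theorem linPart_smul (h : E →L[ℝ] ℂ) (c : ℂ) (v : E) : linPart h (c • v) = c * linPart h v := by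
  have h1 : linPart h (Complex.I • v) = Complex.I * linPart h v := by
    rw [linPart_apply, linPart_apply, smul_smul, Complex.I_mul_I, neg_one_smul, map_neg]
    linear_combination h (Complex.I • v) * Complex.I_sq
  rw [smul_eq_re_add_im, map_add, map_smul, map_smul, h1]
  conv_rhs => rw [← Complex.re_add_im c]
  simp only [Complex.real_smul]
  ring

theorem antiPart_smul (h : E →L[ℝ] ℂ) (c : ℂ) (v : E) :
    antiPart h (c • v) = conj c * antiPart h v := by
  have h1 : antiPart h (Complex.I • v) = -Complex.I * antiPart h v := by
    rw [antiPart_apply, antiPart_apply, smul_smul, Complex.I_mul_I, neg_one_smul, map_neg]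
    linear_combination h (Complex.I • v) * Complex.I_sq
  rw [smul_eq_re_add_im, map_add, map_smul, map_smul, h1]
  conv_rhs => rw [← Complex.re_add_im c]
  simp only [Complex.real_smul, map_add, map_mul, Complex.conj_ofReal, Complex.conj_I]
  ring

/-- The complex linear part of a real-linear map to `ℂ × ℂ`. -/
noncomputable def linPartProd (T : E →L[ℝ] ℂ × ℂ) : E →L[ℝ] ℂ × ℂ :=
  T - Complex.I • T ∘L mulI E

/-- Orthogonality of J says that the vectors v - iJv are isotropic for the complexified Euclidean
form. Hence, in the basis e, e', the conjugates of the antilinear parts are a skew matrix applied to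
the linear parts. A skew 2 × 2 matrix has a single free entry, which is conj k. -/
theorem exists_antiPart_eq {a b : E →L[ℝ] ℂ} {e e' : E} (he1 : linPart a e = 1)
    (he2 : linPart b e = 0) (he1' : linPart a e' = 0) (he2' : linPart b e' = 1)
    (hinj : ∀ v, linPart a v = 0 → linPart b v = 0 → v = 0)
    (hJ : ∀ v w, euclideanForm (a (Complex.I • v), b (Complex.I • v))
      (a (Complex.I • w), b (Complex.I • w)) = euclideanForm (a v, b v) (a w, b w)) :
    ∃ k : ℂ, ∀ v, antiPart a v = k * conj (linPart b v) ∧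
      antiPart b v = -k * conj (linPart a v) := by
  -- The isotropy identity: invariance on (v, v) gives its real part, invariance on (v, iv) its
  -- imaginary part.
  have hq (v : E) : linPart a v * conj (antiPart a v) + linPart b v * conj (antiPart b v) = 0 := by
    have h1 := hJ v v
    have h2 := hJ v (Complex.I • v)
    rw [smul_smul, Complex.I_mul_I, neg_one_smul, map_neg, map_neg] at h2
    rw [euclideanForm_apply, euclideanForm_apply] at h1 h2
    simp only [linPart_apply, antiPart_apply]
    apply Complex.ext
    · simp at h1 h2 ⊢
      linarith
    · simp at h1 h2 ⊢
      linarith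
  have hpol (v w : E) : linPart a v * conj (antiPart a w) + linPart a w * conj (antiPart a v) +
      (linPart b v * conj (antiPart b w) + linPart b w * conj (antiPart b v)) = 0 := by
    have h := hq (v + w)
    simp only [map_add] at h
    linear_combination h - hq v - hq w
  have h1 : antiPart a e = 0 := by
    have := hq e
    rw [he1, he2] at this
    simpa using this
  have h2 : antiPart b e' = 0 := by
    have := hq e'
    rw [he1', he2'] at this
    simpa using this
  have h3 : antiPart b e = -antiPart a e' := by
    have := hpol e e'
    rw [he1, he1', he2, he2'] at this
    simp only [one_mul, zero_mul, add_zero, zero_add, ← map_add, map_eq_zero] at this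
    linear_combination this
  refine ⟨antiPart a e', fun v ↦ ?_⟩
  have hv : v = linPart a v • e + linPart b v • e' := by
    rw [← sub_eq_zero]
    apply hinj
    · simp only [map_sub, map_add, linPart_smul, he1, he1']
      ring
    · simp only [map_sub, map_add, linPart_smul, he2, he2']
      ring
  constructor
  · conv_lhs => rw [hv]
    rw [map_add, antiPart_smul, antiPart_smul, h1]
    ring
  · conv_lhs => rw [hv]
    rw [map_add, antiPart_smul, antiPart_smul, h2, h3]
    ring

theorem differentiableAt_complex_of_antiPart_eq_zero {h : E → ℂ} {y : E}
    (hd : DifferentiableAt ℝ h y) (ha : antiPart (fderiv ℝ h y) = 0) : DifferentiableAt ℂ h y := by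
  rw [differentiableAt_iff_restrictScalars ℝ hd]
  have hI (v : E) : fderiv ℝ h y (Complex.I • v) = Complex.I * fderiv ℝ h y v := by
    have := DFunLike.congr_fun ha v
    rw [antiPart_apply, zero_apply] at this
    linear_combination -Complex.I * this + fderiv ℝ h y (Complex.I • v) * Complex.I_sq
  refine ⟨{ toFun := fderiv ℝ h y, map_add' := map_add _, map_smul' := fun c v ↦ ?_,
            cont := (fderiv ℝ h y).continuous }, rfl⟩
  rw [smul_eq_re_add_im, map_add, map_smul, map_smul, hI, RingHom.id_apply, smul_eq_mul]
  conv_rhs => rw [← Complex.re_add_im c]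
  simp only [Complex.real_smul]
  ring

end DolbeaultParts

/-! ### The coframe in flat coordinates and the local form of part (a) -/

section Coframe

open ComplexConjugate Filter Topology

/-- The value of `φ₁` in terms of the values of `u`, `v`, `f`, `du` and `df`. -/
noncomputable def coframeOne (u v f du df : ℂ) : ℂ :=
  ((1 / (√2 * √(1 + ‖f‖ ^ 2)) : ℝ) : ℂ) * du +
    (((1 / (√2 * (1 + ‖f‖ ^ 2) * √(1 + ‖f‖ ^ 2)) : ℝ) : ℂ) *
      (Complex.I * conj v - u * conj f)) * df

/-- The value of `φ₂` in terms of the values of `u`, `v`, `f`, `dv` and `df`. -/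
noncomputable def coframeTwo (u v f dv df : ℂ) : ℂ :=
  ((1 / (√2 * √(1 + ‖f‖ ^ 2)) : ℝ) : ℂ) * dv -
    (((1 / (√2 * (1 + ‖f‖ ^ 2) * √(1 + ‖f‖ ^ 2)) : ℝ) : ℂ) *
      (Complex.I * conj u + v * conj f)) * df

/-- The expression `φ₁ ⊗ conj φ₁ + conj φ₁ ⊗ φ₁ + φ₂ ⊗ conj φ₂ + conj φ₂ ⊗ φ₂` in terms of the
values `p, q` of `φ₁, φ₂` on the first argument and `p', q'` on the second. -/
noncomputable def coframeSum (p q p' q' : ℂ) : ℂ :=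
  p * conj p' + conj p * p' + (q * conj q' + conj q * q')

theorem coframeSum_eq {u v f A B : ℂ} (hu : u = A - Complex.I * f * conj B)
    (hv : v = B + Complex.I * f * conj A) {a b du dv df a' b' du' dv' df' : ℂ}
    (hdu : du = a - Complex.I * (df * conj B + f * conj b))
    (hdv : dv = b + Complex.I * (df * conj A + f * conj a))
    (hdu' : du' = a' - Complex.I * (df' * conj B + f * conj b'))
    (hdv' : dv' = b' + Complex.I * (df' * conj A + f * conj a')) :
    coframeSum (coframeOne u v f du df) (coframeTwo u v f dv df) (coframeOne u v f du' df')
      (coframeTwo u v f dv' df') = (euclideanForm (a, b) (a', b') : ℝ) := by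
  set l : ℝ := 1 + ‖f‖ ^ 2 with hl
  have hl0 : 0 < l := by positivity
  set s : ℝ := 1 / (√2 * √l) with hs
  have hsl : 1 / (√2 * l * √l) = s / l := by
    rw [hs]
    field_simp
  have hs2 : s ^ 2 * (2 * (1 + ‖f‖ ^ 2)) = 1 := by
    rw [← hl, hs, div_pow, mul_pow, Real.sq_sqrt (by norm_num), Real.sq_sqrt hl0.le]
    field_simp
  simp only [coframeOne, coframeTwo, ← hl, ← hs, hsl]
  rw [coframe_one_eq hl hl0.ne' hu hv hdu, coframe_one_eq hl hl0.ne' hu hv hdu',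
    coframe_two_eq hl hl0.ne' hu hv hdv, coframe_two_eq hl hl0.ne' hu hv hdv', coframeSum,
    coframe_sum_eq hs2]

section Deriv

variable {E : Type*} [NormedAddCommGroup E] [NormedSpace ℝ E]

theorem hasFDerivAt_conj {B : E → ℂ} {B' : E →L[ℝ] ℂ} {y : E} (hB : HasFDerivAt B B' y) :
    HasFDerivAt (fun z ↦ conj (B z)) ((Complex.conjCLE : ℂ →L[ℝ] ℂ) ∘L B') y :=
  HasFDerivAt.comp (g := fun z : ℂ ↦ conj z) (f := B) y
    (Complex.conjCLE : ℂ →L[ℝ] ℂ).hasFDerivAt hB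

theorem fderiv_mul_conj_apply {f B : E → ℂ} {y : E} (hf : DifferentiableAt ℝ f y)
    (hB : DifferentiableAt ℝ B y) : HasFDerivAt (fun z ↦ f z * conj (B z))
      (f y • ((Complex.conjCLE : ℂ →L[ℝ] ℂ) ∘L fderiv ℝ B y) +
        conj (B y) • fderiv ℝ f y) y :=
  hf.hasFDerivAt.mul (hasFDerivAt_conj hB.hasFDerivAt)

/-- The identity behind both directions. Only real differentiability enters, because A and B are in
general not holomorphic. -/
theorem coframeSum_fderiv_eq {u v f A B : E → ℂ} {y : E}
    (hu : u =ᶠ[𝓝 y] fun z ↦ A z - Complex.I * (f z * conj (B z)))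
    (hv : v =ᶠ[𝓝 y] fun z ↦ B z + Complex.I * (f z * conj (A z)))
    (hf : DifferentiableAt ℝ f y) (hA : DifferentiableAt ℝ A y) (hB : DifferentiableAt ℝ B y)
    (w w' : E) :
    coframeSum (coframeOne (u y) (v y) (f y) (fderiv ℝ u y w) (fderiv ℝ f y w))
      (coframeTwo (u y) (v y) (f y) (fderiv ℝ v y w) (fderiv ℝ f y w))
      (coframeOne (u y) (v y) (f y) (fderiv ℝ u y w') (fderiv ℝ f y w'))
      (coframeTwo (u y) (v y) (f y) (fderiv ℝ v y w') (fderiv ℝ f y w')) =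
    (euclideanForm (fderiv ℝ (fun z ↦ (A z, B z)) y w)
      (fderiv ℝ (fun z ↦ (A z, B z)) y w') : ℝ) := by
  have h1 (w : E) : fderiv ℝ u y w = fderiv ℝ A y w -
      Complex.I * (fderiv ℝ f y w * conj (B y) + f y * conj (fderiv ℝ B y w)) := by
    rw [hu.fderiv_eq, (hA.hasFDerivAt.fun_sub ((fderiv_mul_conj_apply hf hB).const_mul
      Complex.I)).fderiv]
    simp
    ring
  have h2 (w : E) : fderiv ℝ v y w = fderiv ℝ B y w +
      Complex.I * (fderiv ℝ f y w * conj (A y) + f y * conj (fderiv ℝ A y w)) := by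
    rw [hv.fderiv_eq, (hB.hasFDerivAt.fun_add ((fderiv_mul_conj_apply hf hA).const_mul
      Complex.I)).fderiv]
    simp
    ring
  rw [(hA.hasFDerivAt.prodMk hB.hasFDerivAt).fderiv]
  exact coframeSum_eq (hu.self_of_nhds.trans (by ring)) (hv.self_of_nhds.trans (by ring))
    (h1 w) (h2 w) (h1 w') (h2 w')

end Deriv

section Complex

variable {E : Type*} [NormedAddCommGroup E] [NormedSpace ℂ E]

theorem linPart_conj (h : E →L[ℝ] ℂ) (v : E) :
    conj (linPart h v) = antiPart ((Complex.conjCLE : ℂ →L[ℝ] ℂ) ∘L h) v := by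
  simp [linPart_apply, antiPart_apply]

/-- The twistor coordinate `k` of an orthogonal complex structure on a flat space is holomorphic
when the complex structure is integrable. -/
theorem antiPart_fderiv_eq_zero {A B k : E → ℂ} {U : Set E} (hU : IsOpen U)
    (hA : ContDiffOn ℝ 2 A U) (hB : ContDiffOn ℝ 2 B U) (hk : DifferentiableOn ℝ k U)
    (h : ∀ y ∈ U, ∀ w, antiPart (fderiv ℝ A y) w = k y * conj (linPart (fderiv ℝ B y) w) ∧
      antiPart (fderiv ℝ B y) w = -k y * conj (linPart (fderiv ℝ A y) w))
    {y : E} (hy : y ∈ U) {e e' : E} (he2 : linPart (fderiv ℝ B y) e = 0)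
    (he1 : linPart (fderiv ℝ A y) e = 1) (he2' : linPart (fderiv ℝ B y) e' = 1) :
    antiPart (fderiv ℝ k y) = 0 := by
  have hd {A : E → ℂ} (hA : ContDiffOn ℝ 2 A U) :
      HasFDerivAt (fderiv ℝ A) (fderiv ℝ (fderiv ℝ A) y) y :=
    (((hA.fderiv_of_isOpen hU (m := 1) (by norm_num)).differentiableOn
      one_ne_zero).differentiableAt (hU.mem_nhds hy)).hasFDerivAt
  have hsym {A : E → ℂ} (hA : ContDiffOn ℝ 2 A U) (v w : E) :
      fderiv ℝ (fderiv ℝ A) y v w = fderiv ℝ (fderiv ℝ A) y w v :=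
    (hA.contDiffAt (hU.mem_nhds hy)).isSymmSndFDerivAt (by simp) v w
  have hk' := (hk.differentiableAt (hU.mem_nhds hy)).hasFDerivAt
  have happ {A : E → ℂ} (hA : ContDiffOn ℝ 2 A U) (w : E) :
      HasFDerivAt (fun z ↦ fderiv ℝ A z w) ((fderiv ℝ (fderiv ℝ A) y).flip w) y := by
    have := (hd hA).clm_apply (hasFDerivAt_const w y)
    convert! this using 1
    ext; simp
  -- Applying ∂̄ to ∂̄A = k ∂̄(conj B) gives ∂̄k ∧ ∂̄(conj B) = 0, since ∂̄² = 0. Used for both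
  -- equations, this makes ∂̄k proportional to two independent forms, hence zero.
  have key {A B k : E → ℂ} (hA : ContDiffOn ℝ 2 A U) (hB : ContDiffOn ℝ 2 B U)
      (hk : HasFDerivAt k (fderiv ℝ k y) y)
      (h : ∀ y ∈ U, ∀ w, antiPart (fderiv ℝ A y) w = k y * conj (linPart (fderiv ℝ B y) w))
      (z w : E) : antiPart (fderiv ℝ k y) z * conj (linPart (fderiv ℝ B y) w) =
        antiPart (fderiv ℝ k y) w * conj (linPart (fderiv ℝ B y) z) := by
    have hdiff (w z : E) : fderiv ℝ (fderiv ℝ A) y z w +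
        Complex.I * fderiv ℝ (fderiv ℝ A) y z (Complex.I • w) =
        fderiv ℝ k y z * conj (linPart (fderiv ℝ B y) w) +
          k y * (conj (fderiv ℝ (fderiv ℝ B) y z w) +
            Complex.I * conj (fderiv ℝ (fderiv ℝ B) y z (Complex.I • w))) := by
      have h1 : HasFDerivAt (fun p ↦ fderiv ℝ A p w + Complex.I * fderiv ℝ A p (Complex.I • w)) _ y :=
        (happ hA w).add ((happ hA (Complex.I • w)).const_mul Complex.I)
      have h2 : HasFDerivAt (fun p ↦ k p * conj (fderiv ℝ B p w -
          Complex.I * fderiv ℝ B p (Complex.I • w))) _ y :=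
        hk.mul (hasFDerivAt_conj ((happ hB w).sub
          ((happ hB (Complex.I • w)).const_mul Complex.I)))
      have h3 := DFunLike.congr_fun (h1.unique (h2.congr_of_eventuallyEq
        (eventually_of_mem (hU.mem_nhds hy) fun p hp ↦ h p hp w))) z
      simp at h3
      rw [linPart_apply, map_sub, map_mul, Complex.conj_I]
      linear_combination h3
    -- Antisymmetrising the (0,1)-parts in z and w takes these four instances; symmetry of second
    -- derivatives removes every second-order term.
    have e1 := hdiff w z
    have e2 := hdiff w (Complex.I • z)
    have e3 := hdiff z w
    have e4 := hdiff z (Complex.I • w)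
    rw [hsym hA w z, hsym hA w (Complex.I • z), hsym hB w z, hsym hB w (Complex.I • z)] at e3
    rw [hsym hA (Complex.I • w) z, hsym hA (Complex.I • w) (Complex.I • z),
      hsym hB (Complex.I • w) z, hsym hB (Complex.I • w) (Complex.I • z)] at e4
    rw [antiPart_apply, antiPart_apply]
    linear_combination -e1 - Complex.I * e2 + e3 + Complex.I * e4
  have k1 (z w : E) := key hA hB hk' (fun y hy w ↦ (h y hy w).1) z w
  have k2 (z w : E) : antiPart (fderiv ℝ k y) z * conj (linPart (fderiv ℝ A y) w) =
        antiPart (fderiv ℝ k y) w * conj (linPart (fderiv ℝ A y) z) := by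
    have hn : fderiv ℝ (fun z ↦ -k z) y = -fderiv ℝ k y := fderiv_fun_neg
    have := key (k := fun z ↦ -k z) hB hA (hn ▸ hk'.neg) (fun y hy w ↦ (h y hy w).2) z w
    rw [hn, show antiPart (-fderiv ℝ k y) = -antiPart (fderiv ℝ k y) by
      ext v; simp [antiPart_apply]; ring, neg_apply, neg_apply] at this
    linear_combination -this
  have h0 : antiPart (fderiv ℝ k y) e = 0 := by
    have := k1 e e'
    rw [he2, he2'] at this
    simpa using this
  ext z
  have := k2 z e
  rw [he1, h0] at this
  simpa using this

theorem isOpen_isInvertible_real {E H : Type*} [NormedAddCommGroup E] [NormedSpace ℝ E]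
    [CompleteSpace E] [NormedAddCommGroup H] [NormedSpace ℝ H] :
    IsOpen {T : E →L[ℝ] H | T.IsInvertible} :=
  ContinuousLinearEquiv.isOpen

variable [FiniteDimensional ℂ E]

/-- A flat Hermitian metric on a domain of a two-dimensional complex vector space has local unitary
coframes given by holomorphic functions `u`, `v`, `f`. -/
theorem exists_coframe_of_flat (hE : Module.finrank ℂ E = 2) {G : E → E →L[ℝ] E →L[ℝ] ℝ}
    {U : Set E} (hU : IsOpen U) {x : E} (hx : x ∈ U) (hG : ContDiffOn ℝ 2 G U)
    (hs : ∀ y ∈ U, ∀ v w, G y v w = G y w v) (hpos : ∀ y ∈ U, ∀ v, v ≠ 0 → 0 < G y v v)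
    (hJ : ∀ y ∈ U, ∀ v w, G y (Complex.I • v) (Complex.I • w) = G y v w)
    (hflat : ∀ y ∈ U, ∀ v w z, leviCivitaCurvature G y v w z = 0) :
    ∃ (W : Set E) (u v f : E → ℂ), IsOpen W ∧ x ∈ W ∧ W ⊆ U ∧ DifferentiableOn ℂ u W ∧
      DifferentiableOn ℂ v W ∧ DifferentiableOn ℂ f W ∧ ∀ y ∈ W, ∀ w w', ((G y w w' : ℝ) : ℂ) =
        coframeSum (coframeOne (u y) (v y) (f y) (fderiv ℂ u y w) (fderiv ℂ f y w))
          (coframeTwo (u y) (v y) (f y) (fderiv ℂ v y w) (fderiv ℂ f y w))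
          (coframeOne (u y) (v y) (f y) (fderiv ℂ u y w') (fderiv ℂ f y w'))
          (coframeTwo (u y) (v y) (f y) (fderiv ℂ v y w') (fderiv ℂ f y w')) := by
  have : FiniteDimensional ℝ E := FiniteDimensional.complexToReal E
  let gx : E →ₗ[ℝ] E →ₗ[ℝ] ℝ := (ContinuousLinearMap.coeLM ℝ).comp (G x).toLinearMap
  obtain ⟨p, q, hpq⟩ := exists_unitary_coframe hE gx (hs x hx) (hpos x hx) (hJ x hx)
  have hpq' (v w : E) : G x v w = (p v * conj (p w)).re + (q v * conj (q w)).re := hpq v w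
  let L : E →L[ℂ] ℂ × ℂ := (p.prod q).toContinuousLinearMap
  have hLa (v : E) : L v = (p v, q v) := rfl
  -- The isometry is normalised to be complex linear at x. Its linear part is then invertible at x,
  -- and by continuity nearby, so the complex structure stays within the range of the coordinate k.
  obtain ⟨V, F, hV, hxV, hVU, hF, hFx, hFG⟩ := exists_isometry_of_flat hU hx hG hs hpos hflat
    euclideanForm (L.restrictScalars ℝ) (fun v w ↦ by
      rw [hpq']
      exact euclideanForm_apply _ _)
  set A : E → ℂ := fun y ↦ (F y).1 with hAdef
  set B : E → ℂ := fun y ↦ (F y).2 with hBdef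
  have hA : ContDiffOn ℝ 2 A V := contDiff_fst.comp_contDiffOn hF
  have hB : ContDiffOn ℝ 2 B V := contDiff_snd.comp_contDiffOn hF
  have hFd : ∀ y ∈ V, HasFDerivAt F (fderiv ℝ F y) y := fun y hy ↦
    ((hF.differentiableOn (by norm_num)).differentiableAt (hV.mem_nhds hy)).hasFDerivAt
  have hAd : ∀ y ∈ V, fderiv ℝ A y = .fst ℝ ℂ ℂ ∘L fderiv ℝ F y := fun y hy ↦ (hFd y hy).fst.fderiv
  have hBd : ∀ y ∈ V, fderiv ℝ B y = .snd ℝ ℂ ℂ ∘L fderiv ℝ F y := fun y hy ↦ (hFd y hy).snd.fderiv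
  have hF1 : ContDiffOn ℝ 1 (fderiv ℝ F) V := hF.fderiv_of_isOpen hV (by norm_num)
  have hSx (v : E) : linPartProd (fderiv ℝ F x) v = (2 : ℂ) • L v := by
    have : linPartProd (fderiv ℝ F x) v = L v - Complex.I • L (Complex.I • v) := by
      rw [hFx]; rfl
    rw [this, map_smul, smul_smul, Complex.I_mul_I, neg_one_smul, two_smul, sub_neg_eq_add]
  have hLker (v : E) (hv : L v = 0) : v = 0 := by
    by_contra hne
    have h1 := hpos x hx v hne
    have h2 : p v = 0 := congrArg Prod.fst hv
    have h3 : q v = 0 := congrArg Prod.snd hv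
    rw [hpq', h2, h3] at h1
    simp at h1
  have hrank : Module.finrank ℝ E = Module.finrank ℝ (ℂ × ℂ) := by
    rw [finrank_real_of_complex, hE, Module.finrank_prod, Complex.finrank_real_complex]
  have hSinv : (linPartProd (fderiv ℝ F x)).IsInvertible := by
    refine isInvertible_of_injective_of_finrank_eq ?_ hrank
    rw [injective_iff_map_eq_zero]
    intro v hv
    rw [hSx] at hv
    exact hLker v ((smul_eq_zero.1 hv).resolve_left two_ne_zero)
  -- A fixed direction on which ∂B does not vanish near x; dividing by its value gives a formula for
  -- k that is visibly differentiable.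
  obtain ⟨e₀, he₀⟩ := hSinv.surjective (0, 1)
  have hScont : ContinuousOn (fun y ↦ linPartProd (fderiv ℝ F y)) V := by
    have h1 := hF1.continuousOn
    unfold linPartProd
    fun_prop
  set W : Set E := V ∩ (fun y ↦ linPartProd (fderiv ℝ F y)) ⁻¹'
    ({T | T.IsInvertible} ∩ {T | (T e₀).2 ≠ 0}) with hWdef
  have hWo : IsOpen W := hScont.isOpen_inter_preimage hV (isOpen_isInvertible_real.inter
    (isOpen_ne.preimage (by fun_prop)))
  have hWV : W ⊆ V := Set.inter_subset_left
  have hxW : x ∈ W := ⟨hxV, hSinv, by simp [he₀]⟩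
  set k : E → ℂ := fun y ↦ antiPart (fderiv ℝ A y) e₀ * (conj (linPart (fderiv ℝ B y) e₀))⁻¹
    with hkdef
  have hframe : ∀ y ∈ W, ∃ e e', linPart (fderiv ℝ A y) e = 1 ∧ linPart (fderiv ℝ B y) e = 0 ∧
      linPart (fderiv ℝ A y) e' = 0 ∧ linPart (fderiv ℝ B y) e' = 1 := by
    rintro y ⟨hyV, hyi, -⟩
    obtain ⟨e, he⟩ := hyi.surjective (1, 0)
    obtain ⟨e', he'⟩ := hyi.surjective (0, 1)
    rw [hAd y hyV, hBd y hyV]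
    exact ⟨e, e', congrArg Prod.fst he, congrArg Prod.snd he, congrArg Prod.fst he',
      congrArg Prod.snd he'⟩
  have he₀ne : ∀ y ∈ W, linPart (fderiv ℝ B y) e₀ ≠ 0 := by
    rintro y ⟨hyV, -, hy⟩
    rw [hBd y hyV]
    exact hy
  have hk : ∀ y ∈ W, ∀ w, antiPart (fderiv ℝ A y) w = k y * conj (linPart (fderiv ℝ B y) w) ∧
      antiPart (fderiv ℝ B y) w = -k y * conj (linPart (fderiv ℝ A y) w) := by
    intro y hy
    obtain ⟨e, e', h1, h2, h3, h4⟩ := hframe y hy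
    obtain ⟨κ, hκ⟩ := exists_antiPart_eq h1 h2 h3 h4 (fun v hv1 hv2 ↦ by
      rw [hAd y (hWV hy)] at hv1
      rw [hBd y (hWV hy)] at hv2
      exact hy.2.1.injective ((Prod.ext hv1 hv2 : linPartProd (fderiv ℝ F y) v = 0).trans
        (map_zero _).symm)) (fun v w ↦ by
      rw [hAd y (hWV hy), hBd y (hWV hy)]
      have h5 := hFG y (hWV hy) (Complex.I • v) (Complex.I • w)
      rw [hJ y (hVU (hWV hy)), ← hFG y (hWV hy)] at h5
      exact h5)
    have : k y = κ := by
      simp only [hkdef]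
      rw [(hκ e₀).1, mul_assoc, mul_inv_cancel₀ ((map_ne_zero _).2 (he₀ne y hy)), mul_one]
    rw [this]
    exact hκ
  have hAdiff : ∀ y ∈ W, DifferentiableAt ℝ A y := fun y hy ↦
    (hA.differentiableOn (by norm_num)).differentiableAt (hV.mem_nhds (hWV hy))
  have hBdiff : ∀ y ∈ W, DifferentiableAt ℝ B y := fun y hy ↦
    (hB.differentiableOn (by norm_num)).differentiableAt (hV.mem_nhds (hWV hy))
  have hkdiff : DifferentiableOn ℝ k W := by
    intro y hy
    have hd {A : E → ℂ} (hA : ContDiffOn ℝ 2 A V) : DifferentiableAt ℝ (fderiv ℝ A) y :=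
      ((hA.fderiv_of_isOpen hV (m := 1) (by norm_num)).differentiableOn
        one_ne_zero).differentiableAt (hV.mem_nhds (hWV hy))
    have hap {A : E → ℂ} (hA : ContDiffOn ℝ 2 A V) (w : E) :
      DifferentiableAt ℝ (fun z ↦ fderiv ℝ A z w) y := (hd hA).clm_apply (differentiableAt_const w)
    refine (DifferentiableAt.mul ?_ (DifferentiableAt.inv ?_
      ((map_ne_zero _).2 (he₀ne y hy)))).differentiableWithinAt
    · exact (hap hA _).add ((hap hA _).const_mul _)
    · exact (hasFDerivAt_conj ((hap hB _).sub
        ((hap hB _).const_mul Complex.I)).hasFDerivAt).differentiableAt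
  have hkd : ∀ y ∈ W, DifferentiableAt ℝ k y := fun y hy ↦ hkdiff.differentiableAt (hWo.mem_nhds hy)
  have hkanti : ∀ y ∈ W, antiPart (fderiv ℝ k y) = 0 := fun y hy ↦ by
    obtain ⟨e, e', h1, h2, h3, h4⟩ := hframe y hy
    exact antiPart_fderiv_eq_zero hWo (hA.mono hWV) (hB.mono hWV) hkdiff hk hy h2 h1 h4
  -- Chosen so that if = k, which turns u = A - k conj B and v = B + k conj A into the relations of
  -- `coframeSum_fderiv_eq`.
  set f : E → ℂ := fun y ↦ -Complex.I * k y with hf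
  set u : E → ℂ := fun y ↦ A y - k y * conj (B y) with hu
  set v : E → ℂ := fun y ↦ B y + k y * conj (A y) with hv
  have hkC : ∀ y ∈ W, DifferentiableAt ℂ k y := fun y hy ↦
    differentiableAt_complex_of_antiPart_eq_zero (hkd y hy) (hkanti y hy)
  have hfC : ∀ y ∈ W, DifferentiableAt ℂ f y := fun y hy ↦ (hkC y hy).const_mul _
  have huC : ∀ y ∈ W, DifferentiableAt ℂ u y := fun y hy ↦ by
    have h1 := (hAdiff y hy).hasFDerivAt.sub (fderiv_mul_conj_apply (hkd y hy) (hBdiff y hy))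
    refine differentiableAt_complex_of_antiPart_eq_zero h1.differentiableAt ?_
    rw [show fderiv ℝ u y = _ from h1.fderiv]
    ext w
    have h2 := (hk y hy w).1
    have h3 := DFunLike.congr_fun (hkanti y hy) w
    rw [linPart_conj] at h2
    simp only [antiPart_apply, zero_apply, sub_apply, add_apply, smul_apply, smul_eq_mul] at h2 h3 ⊢
    -- That is, ∂̄u = (∂̄A - k conj(∂B)) - conj B ∂̄k, and both summands vanish.
    linear_combination h2 - conj (B y) * h3
  have hvC : ∀ y ∈ W, DifferentiableAt ℂ v y := fun y hy ↦ by
    have h1 := (hBdiff y hy).hasFDerivAt.add (fderiv_mul_conj_apply (hkd y hy) (hAdiff y hy))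
    refine differentiableAt_complex_of_antiPart_eq_zero h1.differentiableAt ?_
    rw [show fderiv ℝ v y = _ from h1.fderiv]
    ext w
    have h2 := (hk y hy w).2
    have h3 := DFunLike.congr_fun (hkanti y hy) w
    rw [linPart_conj] at h2
    simp only [antiPart_apply, zero_apply, add_apply, smul_apply, smul_eq_mul] at h2 h3 ⊢
    linear_combination h2 + conj (A y) * h3
  refine ⟨W, u, v, f, hWo, hxW, hWV.trans hVU, fun y hy ↦ (huC y hy).differentiableWithinAt,
    fun y hy ↦ (hvC y hy).differentiableWithinAt, fun y hy ↦ (hfC y hy).differentiableWithinAt,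
    fun y hy w w' ↦ ?_⟩
  have hres {h : E → ℂ} (hd : DifferentiableAt ℂ h y) (w : E) : fderiv ℂ h y w = fderiv ℝ h y w := by
    rw [hd.fderiv_restrictScalars ℝ]; rfl
  simp only [hres (huC y hy), hres (hvC y hy), hres (hfC y hy)]
  have hIk (z : E) : Complex.I * (-Complex.I * k z) = k z := by
    linear_combination -k z * Complex.I_sq
  rw [coframeSum_fderiv_eq (A := A) (B := B) (Eventually.of_forall fun z ↦ ?_)
    (Eventually.of_forall fun z ↦ ?_) ((hfC y hy).restrictScalars ℝ) (hAdiff y hy) (hBdiff y hy),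
    ← hFG y (hWV hy)]
  · simp only [hu, hf, ← mul_assoc, hIk]
  · simp only [hv, hf, ← mul_assoc, hIk]

end Complex

end Coframe

/-! ### Passing between the manifold and its charts -/

section ComplexManifold

open Filter Topology Bundle

variable {E : Type*} [NormedAddCommGroup E] [NormedSpace ℂ E]
  {M : Type*} [TopologicalSpace M] [ChartedSpace E M]

theorem HasMFDerivAt.restrictScalars_complex {F N : Type*} [NormedAddCommGroup F]
    [NormedSpace ℂ F] [TopologicalSpace N] [ChartedSpace F N] {h : M → N} {x : M} {h' : E →L[ℂ] F}
    (hh : HasMFDerivAt 𝓘(ℂ, E) 𝓘(ℂ, F) h x h') :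
    HasMFDerivAt 𝓘(ℝ, E) 𝓘(ℝ, F) h x (h'.restrictScalars ℝ : E →L[ℝ] F) :=
  ⟨hh.1, hh.2.restrictScalars ℝ⟩

/-- The differential at `y` of the parametrization `e.symm` given by a chart `e`. -/
noncomputable def chartSymmDeriv (e : OpenPartialHomeomorph M E) (y : E) : E →L[ℂ] E :=
  mfderiv 𝓘(ℂ, E) 𝓘(ℂ, E) e.symm y

variable [IsManifold 𝓘(ℂ, E) ω M]

theorem mfderiv_real_chart_symm {e : OpenPartialHomeomorph M E} (he : e ∈ atlas E M) {y : E}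
    (hy : y ∈ e.target) : (mfderiv 𝓘(ℝ, E) 𝓘(ℝ, E) e.symm y : E →L[ℝ] E) =
      (chartSymmDeriv e y).restrictScalars ℝ := 
  (HasMFDerivAt.restrictScalars_complex (h' := chartSymmDeriv e y)
    (((mdifferentiable_of_mem_atlas (I := 𝓘(ℂ, E)) he).mdifferentiableAt_symm
      hy).hasMFDerivAt)).mfderiv

theorem chartSymmDeriv_bijective {e : OpenPartialHomeomorph M E} (he : e ∈ atlas E M) {y : E}
    (hy : y ∈ e.target) : Function.Bijective (chartSymmDeriv e y) :=
  (mdifferentiable_of_mem_atlas (I := 𝓘(ℂ, E)) he).symm.mfderiv_bijective hy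

theorem HermitianMetric.inChart_apply (g : HermitianMetric E M) {e : OpenPartialHomeomorph M E}
    (he : e ∈ atlas E M) {y : E} (hy : y ∈ e.target) (v w : E) :
    g.inChart e y v w = g.inner (e.symm y) (chartSymmDeriv e y v) (chartSymmDeriv e y w) := by
  unfold HermitianMetric.inChart
  rw [mfderiv_real_chart_symm he hy]
  rfl

theorem fderiv_comp_chart_symm {h : M → ℂ} {e : OpenPartialHomeomorph M E} (he : e ∈ atlas E M)
    {y : E} (hy : y ∈ e.target) (hh : MDifferentiableAt 𝓘(ℂ, E) 𝓘(ℂ, ℂ) h (e.symm y)) :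
    HasFDerivAt (h ∘ e.symm) ((mvfderiv 𝓘(ℂ, E) h (e.symm y) : E →L[ℂ] ℂ) ∘L chartSymmDeriv e y)
      y :=
  (hh.hasMFDerivAt.comp y (((mdifferentiable_of_mem_atlas (I := 𝓘(ℂ, E)) he).mdifferentiableAt_symm
      hy).hasMFDerivAt)).hasFDerivAt

/-- The preferred trivialization of the tangent bundle at p is given by the differential of the
chart at p, so the bundle coordinates of B near p are those of its pullback G. Both parts use this:
to read a metric in a chart and to prove a constructed one smooth. -/
theorem contMDiffAt_bilinear_iff {B : (x : M) → TangentSpace 𝓘(ℝ, E) x →L[ℝ]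
    TangentSpace 𝓘(ℝ, E) x →L[ℝ] ℝ} {G : E → E →L[ℝ] E →L[ℝ] ℝ} {n : ℕ∞ω} {p : M}
    (hG : ∀ y ∈ (chartAt E p).target, ∀ v w, G y v w =
      B ((chartAt E p).symm y) (chartSymmDeriv (chartAt E p) y v)
        (chartSymmDeriv (chartAt E p) y w)) :
    ContMDiffAt 𝓘(ℝ, E) (𝓘(ℝ, E).prod 𝓘(ℝ, E →L[ℝ] E →L[ℝ] ℝ)) n
      (fun x ↦ TotalSpace.mk' (E →L[ℝ] E →L[ℝ] ℝ)
        (E := fun x : M ↦ TangentSpace 𝓘(ℝ, E) x →L[ℝ] TangentSpace 𝓘(ℝ, E) x →L[ℝ] ℝ)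
        x (B x)) p ↔ ContDiffAt ℝ n G (chartAt E p p) := by
  refine (contMDiffAt_hom_bundle _).trans
    ((and_iff_right (a := ContMDiffAt 𝓘(ℝ, E) 𝓘(ℝ, E) n _ p) contMDiffAt_id).trans ?_)
  set e := chartAt E p with he
  have hloc : (fun x ↦ ContinuousLinearMap.inCoordinates E (fun x ↦ TangentSpace 𝓘(ℝ, E) x)
      (E →L[ℝ] ℝ) (fun x : M ↦ TangentSpace 𝓘(ℝ, E) x →L[ℝ] ℝ) p x p x (B x)) =ᶠ[𝓝 p]
      fun x ↦ G (e x) := by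
    filter_upwards [e.open_source.mem_nhds (mem_chart_source E p)] with x hx
    ext v w
    have hb : x ∈ (trivializationAt E (fun x : M ↦ TangentSpace 𝓘(ℝ, E) x) p).baseSet := by
      simpa using hx
    have hs (v : E) : (trivializationAt E (fun x : M ↦ TangentSpace 𝓘(ℝ, E) x) p).symm x v =
        chartSymmDeriv e (e x) v := by
      have h1 := DFunLike.congr_fun (TangentBundle.symmL_trivializationAt (I := 𝓘(ℝ, E)) hx) v
      have h2 := DFunLike.congr_fun (mfderiv_real_chart_symm (chart_mem_atlas E p)
        (e.map_source hx)) v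
      rw [← mfderivWithin_univ] at h2
      refine ((Trivialization.symmL_apply _ hb _).symm.trans h1).trans (Eq.trans ?_ h2)
      simp
      rfl
    rw [inCoordinates_apply_eq₂ hb hb (by simp), hG _ (e.map_source hx), hs, hs, e.left_inv hx]
    simp
  refine hloc.contMDiffAt_iff.trans ⟨fun h ↦ ?_, fun h ↦ ?_⟩
  · have h2 : ContMDiffAt 𝓘(ℝ, E) 𝓘(ℝ, E →L[ℝ] E →L[ℝ] ℝ) n (fun y ↦ G (e (e.symm y))) (e p) :=
      ContMDiffAt.comp (e p) (g := fun x ↦ G (e x)) (f := e.symm) (by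
        rwa [e.left_inv (mem_chart_source E p)]) (contMDiffOn_chart_symm.contMDiffAt
          (e.open_target.mem_nhds (mem_chart_target E p)))
    refine h2.contDiffAt.congr_of_eventuallyEq ?_
    filter_upwards [e.open_target.mem_nhds (mem_chart_target E p)] with y hy
    rw [e.right_inv hy]
  · exact h.contMDiffAt.comp p (contMDiffOn_chart.contMDiffAt
      (e.open_source.mem_nhds (mem_chart_source E p)))

end ComplexManifold

/-! ### Part (a) on the manifold -/

section UnitaryCoframe

open Filter Topology Bundle ComplexConjugate

theorem coframeSum_self (p q : ℂ) : coframeSum p q p q = ((2 * (‖p‖ ^ 2 + ‖q‖ ^ 2) : ℝ) : ℂ) := by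
  have h (z : ℂ) : z * conj z = ((‖z‖ ^ 2 : ℝ) : ℂ) := by
    rw [Complex.mul_conj, Complex.normSq_eq_norm_sq]
  rw [coframeSum, mul_comm (conj p), mul_comm (conj q), h, h]
  push_cast
  ring

theorem coframeSum_I_mul (p q p' q' : ℂ) :
    coframeSum (Complex.I * p) (Complex.I * q) (Complex.I * p') (Complex.I * q') =
      coframeSum p q p' q' := by
  simp only [coframeSum, map_mul, Complex.conj_I]
  linear_combination (-(p * conj p' + conj p * p' + (q * conj q' + conj q * q'))) * Complex.I_sq

variable {E : Type*} [NormedAddCommGroup E] [NormedSpace ℂ E]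

theorem linearIndependent_and_span_of_injective (hE : Module.finrank ℂ E = 2) {φ ψ : E →L[ℂ] ℂ}
    (h : ∀ z, φ z = 0 → ψ z = 0 → z = 0) :
    LinearIndependent ℂ ![φ, ψ] ∧ ⊤ ≤ Submodule.span ℂ {φ, ψ} := by
  obtain ⟨⟨e, he1, he2⟩, e', he1', he2'⟩ := forms_basis_of_injective hE
    (φ := φ.toLinearMap) (ψ := ψ.toLinearMap) h
  simp only [ContinuousLinearMap.coe_coe] at he1 he2 he1' he2'
  refine ⟨LinearIndependent.pair_iff.2 fun a b hab ↦ ⟨?_, ?_⟩, fun θ _ ↦ ?_⟩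
  · simpa [he1, he2] using DFunLike.congr_fun hab e
  · simpa [he1', he2'] using DFunLike.congr_fun hab e'
  · refine Submodule.mem_span_pair.2 ⟨θ e, θ e', ?_⟩
    ext z
    have hz : z - (φ z • e + ψ z • e') = 0 := h _ (by simp [he1, he1']) (by simp [he2, he2'])
    have := congrArg θ hz
    simp only [map_sub, map_add, map_smul, map_zero, smul_eq_mul] at this
    simp only [add_apply, smul_apply, smul_eq_mul]
    linear_combination -this

variable {M : Type*} [TopologicalSpace M] [ChartedSpace E M] [IsManifold 𝓘(ℂ, E) ω M]

/-- A Hermitian surface whose Levi-Civita connection is flat locally has a unitary coframe of the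
form `phiOne`, `phiTwo`. -/
theorem HermitianMetric.IsRiemannianFlat.exists_isUnitaryCoframeOn {g : HermitianMetric E M}
    (hg : g.IsRiemannianFlat) (hE : Module.finrank ℂ E = 2) (p : M) :
    ∃ (U : Set M) (u v f : M → ℂ), IsOpen U ∧ p ∈ U ∧ MDifferentiableOn 𝓘(ℂ, E) 𝓘(ℂ, ℂ) u U ∧
      MDifferentiableOn 𝓘(ℂ, E) 𝓘(ℂ, ℂ) v U ∧ MDifferentiableOn 𝓘(ℂ, E) 𝓘(ℂ, ℂ) f U ∧
      g.IsUnitaryCoframeOn (phiOne E u v f) (phiTwo E u v f) U := by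
  have : FiniteDimensional ℂ E := Module.finite_of_finrank_eq_succ hE
  set e := chartAt E p
  have he : e ∈ atlas E M := chart_mem_atlas E p
  have hGp : ContDiffAt ℝ ∞ (g.inChart e) (e p) :=
    (contMDiffAt_bilinear_iff fun y hy v w ↦ g.inChart_apply he hy v w).1 (g.contMDiff p)
  -- Smoothness of the coordinate expression is available at the image of p only; being C² there
  -- implies being C² on a neighbourhood.
  obtain ⟨V, hVG, hV, hpV⟩ := eventually_nhds_iff.1
    ((hGp.of_le (m := 2) (by norm_cast)).eventually (by simp))
  have hU : IsOpen (e.target ∩ V) := e.open_target.inter hV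
  obtain ⟨W, u, v, f, hW, hpW, hWU, hu, hv, hf, hG⟩ := exists_coframe_of_flat hE
    (G := g.inChart e) hU ⟨mem_chart_target E p, hpV⟩
    (fun y hy ↦ (hVG y hy.2).contDiffWithinAt)
    (fun y hy v w ↦ by
      rw [g.inChart_apply he hy.1, g.inChart_apply he hy.1]
      exact g.symm _ _ _)
    (fun y hy v hv ↦ by
      rw [g.inChart_apply he hy.1]
      exact g.pos _ _ fun h ↦ hv ((chartSymmDeriv_bijective he hy.1).1 (h.trans (map_zero _).symm)))
    (fun y hy v w ↦ by
      rw [g.inChart_apply he hy.1, g.inChart_apply he hy.1, map_smul, map_smul]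
      exact g.inner_I_smul _ _ _)
    (fun y hy ↦ hg e he y hy.1)
  have hm : MDifferentiableOn 𝓘(ℂ, E) 𝓘(ℂ, E) e (e.source ∩ e ⁻¹' W) :=
    (mdifferentiableOn_atlas he).mono Set.inter_subset_left
  have hcomp {h : E → ℂ} (hh : DifferentiableOn ℂ h W) :
      MDifferentiableOn 𝓘(ℂ, E) 𝓘(ℂ, ℂ) (h ∘ e) (e.source ∩ e ⁻¹' W) :=
    hh.mdifferentiableOn.comp hm fun x hx ↦ hx.2
  have hopen : IsOpen (e.source ∩ e ⁻¹' W) := e.isOpen_inter_preimage hW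
  refine ⟨e.source ∩ e ⁻¹' W, u ∘ e, v ∘ e, f ∘ e, hopen, ⟨mem_chart_source E p, hpW⟩, hcomp hu,
    hcomp hv, hcomp hf, fun x hx ↦ ?_⟩
  have hy : e x ∈ e.target := e.map_source hx.1
  have hd {h : E → ℂ} (hh : DifferentiableOn ℂ h W) (w : E) :
      mvfderiv 𝓘(ℂ, E) (h ∘ e) x (mfderiv 𝓘(ℂ, E) 𝓘(ℂ, E) e.symm (e x) w) = fderiv ℂ h (e x) w := by
    have h1 := fderiv_comp_chart_symm he hy (h := h ∘ e) (by
      rw [e.left_inv hx.1]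
      exact (hcomp hh).mdifferentiableAt (hopen.mem_nhds hx))
    have h2 : (h ∘ e) ∘ e.symm =ᶠ[𝓝 (e x)] h := by
      filter_upwards [e.open_target.mem_nhds hy] with y hy
      simp [e.right_inv hy]
    rw [← h2.fderiv_eq, h1.fderiv, e.left_inv hx.1]
    rfl
  have hsum (w w' : TangentSpace 𝓘(ℂ, E) x) : ((g.inner x w w' : ℝ) : ℂ) =
      coframeSum (phiOne E (u ∘ e) (v ∘ e) (f ∘ e) x w) (phiTwo E (u ∘ e) (v ∘ e) (f ∘ e) x w)
        (phiOne E (u ∘ e) (v ∘ e) (f ∘ e) x w') (phiTwo E (u ∘ e) (v ∘ e) (f ∘ e) x w') := by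
    obtain ⟨w, rfl⟩ := (chartSymmDeriv_bijective he hy).2 w
    obtain ⟨w', rfl⟩ := (chartSymmDeriv_bijective he hy).2 w'
    have h1 := hG (e x) hx.2 w w'
    rw [g.inChart_apply he hy, e.left_inv hx.1, ← hd hu, ← hd hu, ← hd hv, ← hd hv, ← hd hf,
      ← hd hf] at h1
    exact h1
  refine ⟨linearIndependent_and_span_of_injective hE fun z h1 h2 ↦ ?_, hsum⟩
  -- A nonzero vector killed by both forms would have g(z, z) = 0, so the basis property follows
  -- from the metric formula.
  by_contra hz
  have := hsum z z
  rw [coframeSum_self] at this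
  have h3 := g.pos x z hz
  rw [Complex.ofReal_inj.1 this] at h3
  erw [h1, h2] at h3
  simp at h3

end UnitaryCoframe

/-! ### Part (b): the pulled-back Euclidean metric -/

section FlatMetric

open Filter Topology Bundle ComplexConjugate

/-- The Euclidean coordinates `A`, `B`, determined by `u = A - i f conj B` and
`v = B + i f conj A`. -/
noncomputable def twistorMap (z : ℂ × ℂ × ℂ) : ℂ × ℂ :=
  (((1 + ‖z.2.2‖ ^ 2 : ℝ)⁻¹ : ℝ) • (z.1 + Complex.I * (z.2.2 * conj z.2.1)),
    ((1 + ‖z.2.2‖ ^ 2 : ℝ)⁻¹ : ℝ) • (z.2.1 - Complex.I * (z.2.2 * conj z.1)))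

theorem contDiff_twistorMap {n : ℕ∞ω} : ContDiff ℝ n twistorMap := by
  have hc {h : ℂ × ℂ × ℂ → ℂ} (hh : ContDiff ℝ n h) : ContDiff ℝ n fun z ↦ conj (h z) :=
    Complex.conjCLE.contDiff.comp hh
  have h1 : ContDiff ℝ n fun z : ℂ × ℂ × ℂ ↦ z.1 := contDiff_fst
  have h2 : ContDiff ℝ n fun z : ℂ × ℂ × ℂ ↦ z.2.1 := contDiff_fst.comp contDiff_snd
  have h3 : ContDiff ℝ n fun z : ℂ × ℂ × ℂ ↦ z.2.2 := contDiff_snd.comp contDiff_snd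
  have hl : ContDiff ℝ n fun z : ℂ × ℂ × ℂ ↦ (1 + ‖z.2.2‖ ^ 2 : ℝ)⁻¹ :=
    (contDiff_const.add (h3.norm_sq ℝ)).inv fun z ↦ by positivity
  exact (hl.smul (h1.add (contDiff_const.mul (h3.mul (hc h2))))).prodMk
    (hl.smul (h2.sub (contDiff_const.mul (h3.mul (hc h1)))))

/-- Eliminating B gives u + i f conj v = λA, and likewise v - i f conj u = λB. As λ > 0, the
relations are solvable for every u, v, f. -/
theorem twistorMap_inverse (u v f : ℂ) :
    u = (twistorMap (u, v, f)).1 - Complex.I * (f * conj (twistorMap (u, v, f)).2) ∧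
      v = (twistorMap (u, v, f)).2 + Complex.I * (f * conj (twistorMap (u, v, f)).1) := by
  have hl : (1 + ‖f‖ ^ 2 : ℝ) ≠ 0 := by positivity
  have hl' : ((1 : ℂ) + (‖f‖ : ℂ) ^ 2) ≠ 0 := by exact_mod_cast hl
  have hf : f * conj f = (‖f‖ : ℂ) ^ 2 := by
    rw [Complex.mul_conj, Complex.normSq_eq_norm_sq]; norm_cast
  simp only [twistorMap, Complex.real_smul, map_mul, map_add, map_sub, Complex.conj_ofReal,
    Complex.conj_I, Complex.conj_conj]
  push_cast
  constructor
  · field_simp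
    linear_combination (-u) * hf + (u * f * conj f) * Complex.I_sq
  · field_simp
    linear_combination (-v) * hf + (v * f * conj f) * Complex.I_sq

variable {E : Type*} [NormedAddCommGroup E] [NormedSpace ℂ E] [FiniteDimensional ℂ E]
  {M : Type*} [TopologicalSpace M] [ChartedSpace E M] [IsManifold 𝓘(ℂ, E) ω M]

/-- The map to Euclidean space given by holomorphic functions `u`, `v`, `f`. -/
noncomputable def twistorCoord (u v f : M → ℂ) (x : M) : ℂ × ℂ := twistorMap (u x, v x, f x)

variable (E) in
/-- The differential of `twistorCoord`. -/
noncomputable def twistorDeriv (u v f : M → ℂ) (x : M) : E →L[ℝ] ℂ × ℂ :=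
  mfderiv 𝓘(ℝ, E) 𝓘(ℝ, ℂ × ℂ) (twistorCoord u v f) x

variable {u v f : M → ℂ} {e : OpenPartialHomeomorph M E}

theorem contDiffOn_comp_chart_symm {h : M → ℂ} (hh : MDifferentiable 𝓘(ℂ, E) 𝓘(ℂ, ℂ) h)
    (he : e ∈ atlas E M) : ContDiffOn ℝ ∞ (h ∘ e.symm) e.target := by
  have hd : DifferentiableOn ℂ (h ∘ e.symm) e.target := fun y hy ↦
    (fderiv_comp_chart_symm he hy (hh _)).differentiableAt.differentiableWithinAt
  exact contDiffOn_infty.2 fun n ↦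
    (contDiffOn_of_differentiableOn_complex e.open_target n hd).restrict_scalars ℝ

theorem contDiffOn_twistorCoord_comp_chart_symm (hu : MDifferentiable 𝓘(ℂ, E) 𝓘(ℂ, ℂ) u)
    (hv : MDifferentiable 𝓘(ℂ, E) 𝓘(ℂ, ℂ) v) (hf : MDifferentiable 𝓘(ℂ, E) 𝓘(ℂ, ℂ) f)
    (he : e ∈ atlas E M) : ContDiffOn ℝ ∞ (twistorCoord u v f ∘ e.symm) e.target :=
  contDiff_twistorMap.comp_contDiffOn ((contDiffOn_comp_chart_symm hu he).prodMk
    ((contDiffOn_comp_chart_symm hv he).prodMk (contDiffOn_comp_chart_symm hf he)))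

omit [FiniteDimensional ℂ E] in
theorem fderiv_twistorCoord_comp_chart_symm (hu : MDifferentiable 𝓘(ℂ, E) 𝓘(ℂ, ℂ) u)
    (hv : MDifferentiable 𝓘(ℂ, E) 𝓘(ℂ, ℂ) v) (hf : MDifferentiable 𝓘(ℂ, E) 𝓘(ℂ, ℂ) f)
    (he : e ∈ atlas E M) {y : E} (hy : y ∈ e.target) :
    fderiv ℝ (twistorCoord u v f ∘ e.symm) y =
      twistorDeriv E u v f (e.symm y) ∘L (chartSymmDeriv e y).restrictScalars ℝ := by
  have hr {h : M → ℂ} (hh : MDifferentiable 𝓘(ℂ, E) 𝓘(ℂ, ℂ) h) (x : M) :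
      MDifferentiableAt 𝓘(ℝ, E) 𝓘(ℝ, ℂ) h x :=
    (HasMFDerivAt.restrictScalars_complex (E := E) (F := ℂ)
      (h' := mvfderiv 𝓘(ℂ, E) h x) (hh x).hasMFDerivAt).mdifferentiableAt
  have h1 (x : M) : MDifferentiableAt 𝓘(ℝ, E) 𝓘(ℝ, ℂ × ℂ) (twistorCoord u v f) x :=
    ((contDiff_twistorMap (n := 1)).contMDiff.mdifferentiableAt one_ne_zero).comp x
      ((hr hu x).prodMk_space ((hr hv x).prodMk_space (hr hf x)))
  have h2 : HasMFDerivAt 𝓘(ℝ, E) 𝓘(ℝ, E) e.symm y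
      ((chartSymmDeriv e y).restrictScalars ℝ : E →L[ℝ] E) :=
    HasMFDerivAt.restrictScalars_complex (h' := chartSymmDeriv e y)
      ((mdifferentiable_of_mem_atlas (I := 𝓘(ℂ, E)) he).mdifferentiableAt_symm hy).hasMFDerivAt
  have h3 : HasMFDerivAt 𝓘(ℝ, E) 𝓘(ℝ, ℂ × ℂ) (twistorCoord u v f ∘ e.symm) y
      (twistorDeriv E u v f (e.symm y) ∘L (chartSymmDeriv e y).restrictScalars ℝ) :=
    (h1 (e.symm y)).hasMFDerivAt.comp y h2
  exact mfderiv_eq_fderiv.symm.trans h3.mfderiv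

/-- The chart at x reduces this to `coframeSum_fderiv_eq`. It identifies the only candidate for the
metric with a pullback of the Euclidean one, giving smoothness, J-invariance and flatness at once.
-/
theorem coframeSum_phi_eq (hu : MDifferentiable 𝓘(ℂ, E) 𝓘(ℂ, ℂ) u)
    (hv : MDifferentiable 𝓘(ℂ, E) 𝓘(ℂ, ℂ) v) (hf : MDifferentiable 𝓘(ℂ, E) 𝓘(ℂ, ℂ) f)
    (x : M) (w w' : TangentSpace 𝓘(ℂ, E) x) :
    coframeSum (phiOne E u v f x w) (phiTwo E u v f x w) (phiOne E u v f x w')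
      (phiTwo E u v f x w') =
      (euclideanForm (twistorDeriv E u v f x w) (twistorDeriv E u v f x w') : ℝ) := by
  set e := chartAt E x
  have he : e ∈ atlas E M := chart_mem_atlas E x
  have hy : e x ∈ e.target := mem_chart_target E x
  have hx : e.symm (e x) = x := e.left_inv (mem_chart_source E x)
  obtain ⟨w, rfl⟩ := (chartSymmDeriv_bijective he hy).2 w
  obtain ⟨w', rfl⟩ := (chartSymmDeriv_bijective he hy).2 w'
  have hF := contDiffOn_twistorCoord_comp_chart_symm hu hv hf he
  have hFd := (hF.contDiffAt (e.open_target.mem_nhds hy)).differentiableAt (by simp)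
  have hdf := ((contDiffOn_comp_chart_symm hf he).contDiffAt
    (e.open_target.mem_nhds hy)).differentiableAt (by simp)
  have hd {h : M → ℂ} (hh : MDifferentiable 𝓘(ℂ, E) 𝓘(ℂ, ℂ) h) (w : E) :
      fderiv ℝ (h ∘ e.symm) (e x) w = mvfderiv 𝓘(ℂ, E) h x (chartSymmDeriv e (e x) w) := by
    rw [((fderiv_comp_chart_symm he hy (hh _)).restrictScalars ℝ).fderiv, hx]
    rfl
  have key := coframeSum_fderiv_eq (u := u ∘ e.symm) (v := v ∘ e.symm) (f := f ∘ e.symm)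
    (A := fun y ↦ ((twistorCoord u v f ∘ e.symm) y).1)
    (B := fun y ↦ ((twistorCoord u v f ∘ e.symm) y).2) (y := e x)
    (.of_forall fun y ↦ (twistorMap_inverse _ _ _).1)
    (.of_forall fun y ↦ (twistorMap_inverse _ _ _).2) hdf hFd.fst hFd.snd w w'
  simp only [Prod.mk.eta] at key
  rw [hd hu, hd hu, hd hv, hd hv, hd hf, hd hf] at key
  have hF' := fderiv_twistorCoord_comp_chart_symm hu hv hf he hy
  rw [hx] at hF'
  have hF'' (w : E) : fderiv ℝ (fun y ↦ (twistorCoord u v f ∘ e.symm) y) (e x) w =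
    twistorDeriv E u v f x (chartSymmDeriv e (e x) w) := DFunLike.congr_fun hF' w
  rw [hF'', hF''] at key
  simp only [Function.comp_apply, hx] at key
  exact key

/-- On a vector killed by the differential, 2(|φ₁|² + |φ₂|²) vanishes, so both forms do; their
independence makes the vector zero. -/
theorem twistorDeriv_injective (hE : Module.finrank ℂ E = 2)
    (hu : MDifferentiable 𝓘(ℂ, E) 𝓘(ℂ, ℂ) u) (hv : MDifferentiable 𝓘(ℂ, E) 𝓘(ℂ, ℂ) v)
    (hf : MDifferentiable 𝓘(ℂ, E) 𝓘(ℂ, ℂ) f) {x : M}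
    (hw : wedgeAt (phiOne E u v f) (phiTwo E u v f) x ≠ 0) {z : E}
    (hz : twistorDeriv E u v f x z = 0) : z = 0 := by
  have h := coframeSum_phi_eq hu hv hf x z z
  rw [coframeSum_self] at h
  have h' := Complex.ofReal_inj.1 h
  erw [hz] at h'
  simp only [map_zero] at h'
  have h1 : phiOne E u v f x z = 0 := by
    have : ‖phiOne E u v f x z‖ ^ 2 = 0 := by
      nlinarith [sq_nonneg ‖phiOne E u v f x z‖, sq_nonneg ‖phiTwo E u v f x z‖]
    simpa using this
  have h2 : phiTwo E u v f x z = 0 := by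
    have : ‖phiTwo E u v f x z‖ ^ 2 = 0 := by
      nlinarith [sq_nonneg ‖phiOne E u v f x z‖, sq_nonneg ‖phiTwo E u v f x z‖]
    simpa using this
  obtain ⟨a, ha⟩ := Function.ne_iff.1 hw
  obtain ⟨b, hb⟩ := Function.ne_iff.1 ha
  exact eq_zero_of_forms_wedge_ne_zero hE (φ := (phiOne E u v f x : E →L[ℂ] ℂ).toLinearMap)
    (ψ := (phiTwo E u v f x : E →L[ℂ] ℂ).toLinearMap) hb h1 h2

/-- The pullback of the Euclidean metric by `twistorCoord u v f`. -/
noncomputable def flatMetric (hE : Module.finrank ℂ E = 2)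
    (hu : MDifferentiable 𝓘(ℂ, E) 𝓘(ℂ, ℂ) u) (hv : MDifferentiable 𝓘(ℂ, E) 𝓘(ℂ, ℂ) v)
    (hf : MDifferentiable 𝓘(ℂ, E) 𝓘(ℂ, ℂ) f)
    (hw : ∀ x : M, wedgeAt (phiOne E u v f) (phiTwo E u v f) x ≠ 0) : HermitianMetric E M where
  inner x := euclideanForm.bilinearComp (twistorDeriv E u v f x) (twistorDeriv E u v f x)
  symm x v w := euclideanForm_comm _ _
  pos x v h := euclideanForm_pos _ fun h' ↦ h (twistorDeriv_injective hE hu hv hf (hw x) h')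
  isVonNBounded x := by
    have : FiniteDimensional ℝ E := FiniteDimensional.complexToReal E
    -- An injective linear map on a finite-dimensional space is bounded below, so the unit ball of
    -- the pulled-back form is bounded in E.
    obtain ⟨K, -, hK⟩ := (twistorDeriv E u v f x).toLinearMap.exists_antilipschitzWith
      ((LinearMap.ker_eq_bot').2 fun z hz ↦ twistorDeriv_injective hE hu hv hf (hw x) hz)
    refine (NormedSpace.isVonNBounded_iff' ℝ (E := E)).2 ⟨K * 1, fun z hz ↦ ?_⟩
    have h1 : ‖z‖ ≤ K * ‖twistorDeriv E u v f x z‖ := hK.le_mul_norm (map_zero _) z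
    refine h1.trans (mul_le_mul_of_nonneg_left ?_ K.2)
    have h2 : ‖(twistorDeriv E u v f x z).1‖ ^ 2 + ‖(twistorDeriv E u v f x z).2‖ ^ 2 < 1 := by
      rw [← euclideanForm_self]
      exact hz
    refine max_le ?_ ?_ <;> refine (sq_le_sq₀ (norm_nonneg _) zero_le_one).1 ?_
    · nlinarith [sq_nonneg ‖(twistorDeriv E u v f x z).2‖]
    · nlinarith [sq_nonneg ‖(twistorDeriv E u v f x z).1‖]
  contMDiff p := by
    have he : chartAt E p ∈ atlas E M := chart_mem_atlas E p
    have hF := (contDiffOn_twistorCoord_comp_chart_symm hu hv hf he).fderiv_of_isOpen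
      (chartAt E p).open_target (m := ∞) (by simp)
    have hG : ContDiffOn ℝ ∞ (fun y ↦ euclideanForm.bilinearComp
      (fderiv ℝ (twistorCoord u v f ∘ (chartAt E p).symm) y)
      (fderiv ℝ (twistorCoord u v f ∘ (chartAt E p).symm) y)) (chartAt E p).target := by
      -- `bilinearComp` is composition in one argument, a flip, composition in the other and a flip
      -- back; each is smooth.
      have hflip {F : E → E →L[ℝ] ℂ × ℂ →L[ℝ] ℝ} {s : Set E} (h : ContDiffOn ℝ ∞ F s) :
          ContDiffOn ℝ ∞ (fun y ↦ (F y).flip) s :=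
        (ContinuousLinearMap.flipₗᵢ ℝ E (ℂ × ℂ) ℝ).contDiff.comp_contDiffOn h
      exact (ContinuousLinearMap.flipₗᵢ ℝ E E ℝ).contDiff.comp_contDiffOn
        ((hflip (contDiffOn_const.clm_comp hF)).clm_comp hF)
    refine (contMDiffAt_bilinear_iff fun y hy v w ↦ ?_).2 (hG.contDiffAt
      ((chartAt E p).open_target.mem_nhds (mem_chart_target E p)))
    rw [fderiv_twistorCoord_comp_chart_symm hu hv hf he hy]
    rfl
  inner_I_smul x w w' := by
    refine Complex.ofReal_injective ?_
    refine (coframeSum_phi_eq hu hv hf x _ _).symm.trans (Eq.trans ?_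
      (coframeSum_phi_eq hu hv hf x w w'))
    rw [map_smul, map_smul, map_smul, map_smul]
    exact coframeSum_I_mul _ _ _ _

theorem isUnitaryCoframeOn_flatMetric (hE : Module.finrank ℂ E = 2)
    (hu : MDifferentiable 𝓘(ℂ, E) 𝓘(ℂ, ℂ) u) (hv : MDifferentiable 𝓘(ℂ, E) 𝓘(ℂ, ℂ) v)
    (hf : MDifferentiable 𝓘(ℂ, E) 𝓘(ℂ, ℂ) f)
    (hw : ∀ x : M, wedgeAt (phiOne E u v f) (phiTwo E u v f) x ≠ 0) :
    (flatMetric hE hu hv hf hw).IsUnitaryCoframeOn (phiOne E u v f) (phiTwo E u v f) Set.univ := by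
  refine fun x _ ↦ ⟨linearIndependent_and_span_of_injective hE fun z h1 h2 ↦ ?_, fun w w' ↦
    (coframeSum_phi_eq hu hv hf x w w').symm⟩
  obtain ⟨a, ha⟩ := Function.ne_iff.1 (hw x)
  obtain ⟨b, hb⟩ := Function.ne_iff.1 ha
  exact eq_zero_of_forms_wedge_ne_zero hE (φ := (phiOne E u v f x : E →L[ℂ] ℂ).toLinearMap)
    (ψ := (phiTwo E u v f x : E →L[ℂ] ℂ).toLinearMap) hb h1 h2

-- The coframe formula fixes the inner product on every tangent space, and all other fields of a
-- Hermitian metric are propositions.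
omit [FiniteDimensional ℂ E] in
theorem HermitianMetric.IsUnitaryCoframeOn.unique {g g' : HermitianMetric E M}
    {φ ψ : (x : M) → TangentSpace 𝓘(ℂ, E) x →L[ℂ] ℂ} (h : g.IsUnitaryCoframeOn φ ψ Set.univ)
    (h' : g'.IsUnitaryCoframeOn φ ψ Set.univ) : g' = g := by
  have key : g'.inner = g.inner := by
    funext x
    ext v w
    exact Complex.ofReal_injective (((h' x trivial).2 v w).trans ((h x trivial).2 v w).symm)
  obtain ⟨⟨_, _, _, _, _⟩, _⟩ := g
  obtain ⟨⟨_, _, _, _, _⟩, _⟩ := g'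
  subst key
  rfl

theorem isRiemannianFlat_flatMetric (hE : Module.finrank ℂ E = 2)
    (hu : MDifferentiable 𝓘(ℂ, E) 𝓘(ℂ, ℂ) u) (hv : MDifferentiable 𝓘(ℂ, E) 𝓘(ℂ, ℂ) v)
    (hf : MDifferentiable 𝓘(ℂ, E) 𝓘(ℂ, ℂ) f)
    (hw : ∀ x : M, wedgeAt (phiOne E u v f) (phiTwo E u v f) x ≠ 0) :
    (flatMetric hE hu hv hf hw).IsRiemannianFlat := by
  have : FiniteDimensional ℝ E := FiniteDimensional.complexToReal E
  intro e he y hy v' w' z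
  refine leviCivitaCurvature_pullback_eq_zero e.open_target
    ((contDiffOn_twistorCoord_comp_chart_symm hu hv hf he).of_le (by norm_cast))
    euclideanForm_comm euclideanForm_pos (fun y hy v w ↦ ?_) (fun y hy ↦ ?_) hy v' w' z
  · rw [HermitianMetric.inChart_apply _ he hy, fderiv_twistorCoord_comp_chart_symm hu hv hf he hy]
    rfl
  · refine isInvertible_of_injective_of_finrank_eq ?_ ?_
    · rw [injective_iff_map_eq_zero]
      intro z hz
      rw [fderiv_twistorCoord_comp_chart_symm hu hv hf he hy] at hz
      exact (chartSymmDeriv_bijective he hy).1 ((twistorDeriv_injective hE hu hv hf (hw _)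
        hz).trans (map_zero _).symm)
    · rw [finrank_real_of_complex, hE, Module.finrank_prod, Complex.finrank_real_complex]

end FlatMetric

theorem lemma14 (M : Type*) [TopologicalSpace M] [ChartedSpace (EuclideanSpace ℂ (Fin 2)) M]
    [IsManifold 𝓘(ℂ, EuclideanSpace ℂ (Fin 2)) ω M] :
    (∀ g : HermitianMetric (EuclideanSpace ℂ (Fin 2)) M, g.IsRiemannianFlat →
      ∀ p : M, ∃ (U : Set M) (u v f : M → ℂ), IsOpen U ∧ p ∈ U ∧
        MDifferentiableOn 𝓘(ℂ, EuclideanSpace ℂ (Fin 2)) 𝓘(ℂ, ℂ) u U ∧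
        MDifferentiableOn 𝓘(ℂ, EuclideanSpace ℂ (Fin 2)) 𝓘(ℂ, ℂ) v U ∧
        MDifferentiableOn 𝓘(ℂ, EuclideanSpace ℂ (Fin 2)) 𝓘(ℂ, ℂ) f U ∧
        g.IsUnitaryCoframeOn (phiOne (EuclideanSpace ℂ (Fin 2)) u v f)
          (phiTwo (EuclideanSpace ℂ (Fin 2)) u v f) U) ∧
    (∀ u v f : M → ℂ,
      MDifferentiable 𝓘(ℂ, EuclideanSpace ℂ (Fin 2)) 𝓘(ℂ, ℂ) u →
      MDifferentiable 𝓘(ℂ, EuclideanSpace ℂ (Fin 2)) 𝓘(ℂ, ℂ) v →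
      MDifferentiable 𝓘(ℂ, EuclideanSpace ℂ (Fin 2)) 𝓘(ℂ, ℂ) f →
      (∀ x : M, wedgeAt (phiOne (EuclideanSpace ℂ (Fin 2)) u v f)
        (phiTwo (EuclideanSpace ℂ (Fin 2)) u v f) x ≠ 0) →
      ∃ g : HermitianMetric (EuclideanSpace ℂ (Fin 2)) M,
        g.IsUnitaryCoframeOn (phiOne (EuclideanSpace ℂ (Fin 2)) u v f)
          (phiTwo (EuclideanSpace ℂ (Fin 2)) u v f) Set.univ ∧
        (∀ g' : HermitianMetric (EuclideanSpace ℂ (Fin 2)) M,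
          g'.IsUnitaryCoframeOn (phiOne (EuclideanSpace ℂ (Fin 2)) u v f)
            (phiTwo (EuclideanSpace ℂ (Fin 2)) u v f) Set.univ → g' = g) ∧
        g.IsRiemannianFlat) := by
  have hE : Module.finrank ℂ (EuclideanSpace ℂ (Fin 2)) = 2 := by simp
  refine ⟨fun g hg p ↦ hg.exists_isUnitaryCoframeOn hE p, fun u v f hu hv hf hw ↦ ?_⟩
  exact ⟨flatMetric hE hu hv hf hw, isUnitaryCoframeOn_flatMetric hE hu hv hf hw,
    fun g' hg' ↦ (isUnitaryCoframeOn_flatMetric hE hu hv hf hw).unique hg',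
    isRiemannianFlat_flatMetric hE hu hv hf hw⟩
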